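/- Let $n\ge 0$ and let $X_1,\dots,X_n$ be independent real random variables with a common continuous distribution function $F$; put $\mathcal F_i=\sigma(X_1,\dots,X_i)$. A feasible policy $\pi\in\Pi(n)$ is a choice of events $A_i\in\mathcal F_i$, $1\le i\le n$ ($A_i$ is the event that $X_i$ is selected), such that almost surely the selected subsequence is unimodal, i.e. weakly increasing up to some term and weakly decreasing from that term on. Let $U^o_n(\pi)=\sum_{i=1}^n \mathbf 1_{A_i}$ be the number of selected observations. A policy is optimal if it is feasible and maximizes $\mathbb E[U^o_n(\pi)]$ over $\Pi(n)$. For $s\in[0,1]$ and $r\in\{0,1\}$ let $v_{n+1}(s,r)=0$ and, for $i=n,n-1,\dots,1$, $$v_i(s,0)=\int_0^s\max\{v_{i+1}(s,0),1+v_{i+1}(x,1)\}\,dx+\int_s^1\max\{v_{i+1}(s,0),1+v_{i+1}(x,0)\}\,dx,$$ $$v_i(s,1)=(1-s)\,v_{i+1}(s,1)+\int_0^s\max\{v_{i+1}(s,1),1+v_{i+1}(x,1)\}\,dx$$ (the Bellman equation), and set $$a^*(i,s,r)=\inf\{x\in[0,s]: v_{i+1}(s,r)\le 1+v_{i+1}(x,1)\},$$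 $$b^*(i,s,0)=\sup\{x\in[s,1]: v_{i+1}(s,0)\le 1+v_{i+1}(x,0)\},\qquad b^*(i,s,1)=s,$$ where the infimum is taken in $[0,s]$, so that it equals $s$ if the set is empty. The interval policy $\pi^*_n$ selects $X_i$ if and only if $F(X_i)\in[a^*(i,S_{i-1},R_{i-1}),\,b^*(i,S_{i-1},R_{i-1})]$, where $S_0=R_0=0$; if $X_i$ is selected then $S_i=F(X_i)$, and $R_i=1$ if $F(X_i)<S_{i-1}$ and $R_i=R_{i-1}$ otherwise; if $X_i$ is not selected then $(S_i,R_i)=(S_{i-1},R_{i-1})$. Corollary. The policy $\pi^*_n$ belongs to $\Pi(n)$ and is optimal, and it is the unique optimal policy: if $\pi\in\Pi(n)$ is optimal then, for each $1\le i\le n$, almost surely $\pi$ selects $X_i$ if and only if $\pi^*_n$ does. Moreover: (i) For $1\le i\le n$, $s\in[0,1]$, $r\in\{0,1\}$, $v_i(s,r)$ is the maximal expected number of selections from $X_i,\dots,X_n$ over all choices of events $A_j\in\mathcal F_j$, $i\le j\le n$, for which almost surely the sequence consisting of $s$ followed by the selected values $F(X_j)$ is unimodal (if $r=0$), respectively weakly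 decreasing (if $r=1$); the maximum is attained. (ii) For $1\le i\le n$ the maps $s\mapsto v_i(s,r)$ are continuous on $[0,1]$; $s\mapsto v_i(s,0)$ is strictly decreasing on $[0,1]$ for $1\le i\le n-1$, and $s\mapsto v_i(s,1)$ is strictly increasing on $[0,1]$ for $1\le i\le n$. (iii) Call $(a,b)$ admissible thresholds if $0\le a(i,s,r)\le s$, $s\le b(i,s,0)\le 1$ and $b(i,s,1)=s$ for all $1\le i\le n$, $s\in[0,1]$, $r\in\{0,1\}$. Then $(a^*,b^*)$ is admissible, and it is the only admissible pair such that, with $a=a(i,s,r)$, $b=b(i,s,r)$, $$v_i(s,r)=(1-(b-a))\,v_{i+1}(s,r)+\int_a^s(1+v_{i+1}(x,1))\,dx+\int_s^b(1+v_{i+1}(x,0))\,dx$$ for all $1\le i\le n$, $s\in[0,1]$ and $r\in\{0,1\}$. -/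

import Mathlib

open MeasureTheory ProbabilityTheory

namespace UnimodalSelection

noncomputable section

/-! ### Sequential selection of a unimodal subsequence

The observations are `X 1, …, X n`; values of `X` at other indices are never used. -/

/-- The values `x j`, `j ∈ T`, read in the order of their indices, increase weakly up to some
turning place `t` and decrease weakly from there on. -/
def IsUnimodalOn (x : ℕ → ℝ) (T : Set ℕ) : Prop :=
  T = ∅ ∨ ∃ t ∈ T, MonotoneOn x {j ∈ T | j ≤ t} ∧ AntitoneOn x {j ∈ T | t ≤ j}

/-- The `σ`-field generated by `X 1, …, X i`. -/
abbrev history {Ω : Type*} (X : ℕ → Ω → ℝ) (i : ℕ) : MeasurableSpace Ω :=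
  ⨆ j ∈ Set.Icc 1 i, MeasurableSpace.comap (X j) inferInstance

/-- The feasible policies. A policy is given by the events `A i` that `X i` is selected,
`1 ≤ i ≤ n`; it is non-anticipating, and the selected subsequence is almost surely unimodal. -/
def policies {Ω : Type*} [MeasurableSpace Ω] (μ : Measure Ω) (X : ℕ → Ω → ℝ) (n : ℕ) :
    Set (ℕ → Set Ω) :=
  {A | (∀ i ∈ Set.Icc 1 n, MeasurableSet[history X i] (A i)) ∧
    ∀ᵐ ω ∂μ, IsUnimodalOn (fun j => X j ω) {j ∈ Set.Icc 1 n | ω ∈ A j}}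

/-- The number of observations among `X i, …, X n` that are selected. -/
def numSelected {Ω : Type*} (A : ℕ → Set Ω) (i n : ℕ) (ω : Ω) : ℝ :=
  ∑ j ∈ Finset.Icc i n, (A j).indicator (fun _ => (1 : ℝ)) ω

/-- `A` is feasible and maximizes the expected number of selected observations. -/
def IsOptimal {Ω : Type*} [MeasurableSpace Ω] (μ : Measure Ω) (X : ℕ → Ω → ℝ) (n : ℕ)
    (A : ℕ → Set Ω) : Prop :=
  A ∈ policies μ X n ∧
    ∀ A' ∈ policies μ X n, ∫ ω, numSelected A' 1 n ω ∂μ ≤ ∫ ω, numSelected A 1 n ω ∂μ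

/-! ### The value function -/

/-- The Bellman recursion, indexed by the number of observations that are still to come. The state
`(s, r)` holds the last selected value `s` (on the scale `[0, 1]`), and `r = 0` as long as the
selected values increase, `r = 1` afterwards. -/
def valueToGo : ℕ → ℝ → Fin 2 → ℝ
  | 0 => fun _ _ => 0
  | m + 1 => fun s r =>
      if r = 0 then
        (∫ x in (0 : ℝ)..s, max (valueToGo m s 0) (1 + valueToGo m x 1)) +
          ∫ x in s..1, max (valueToGo m s 0) (1 + valueToGo m x 0)
      else
        (1 - s) * valueToGo m s 1 +
          ∫ x in (0 : ℝ)..s, max (valueToGo m s 1) (1 + valueToGo m x 1)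

/-- `v_i(s, r)` for `n` observations: the solution of the Bellman equation with `v_{n+1} = 0`. -/
def value (n i : ℕ) : ℝ → Fin 2 → ℝ := valueToGo (n + 1 - i)

/-- The policies for the observations `X i, …, X n` when the state before time `i` is `(s, r)`: the
sequence that starts with `s`, put at the index `i - 1`, and goes on with the selected values
`F (X j)` has to be unimodal if `r = 0`, and decreasing if `r = 1`. -/
def policiesFrom {Ω : Type*} [MeasurableSpace Ω] (μ : Measure Ω) (F : ℝ → ℝ) (X : ℕ → Ω → ℝ)
    (n i : ℕ) (s : ℝ) (r : Fin 2) : Set (ℕ → Set Ω) :=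
  {A | (∀ j ∈ Set.Icc i n, MeasurableSet[history X j] (A j)) ∧
    ∀ᵐ ω ∂μ,
      if r = 0 then
        IsUnimodalOn (Function.update (fun j => F (X j ω)) (i - 1) s)
          (insert (i - 1) {j ∈ Set.Icc i n | ω ∈ A j})
      else
        AntitoneOn (Function.update (fun j => F (X j ω)) (i - 1) s)
          (insert (i - 1) {j ∈ Set.Icc i n | ω ∈ A j})}

/-! ### Interval policies -/

/-- The admissible pairs of lower and upper thresholds. -/
structure IsThresholds (n : ℕ) (a b : ℕ → ℝ → Fin 2 → ℝ) : Prop where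
  lower : ∀ i ∈ Set.Icc 1 n, ∀ s ∈ Set.Icc (0 : ℝ) 1, ∀ r, a i s r ∈ Set.Icc 0 s
  upper_zero : ∀ i ∈ Set.Icc 1 n, ∀ s ∈ Set.Icc (0 : ℝ) 1, b i s 0 ∈ Set.Icc s 1
  upper_one : ∀ i ∈ Set.Icc 1 n, ∀ s ∈ Set.Icc (0 : ℝ) 1, b i s 1 = s

/-- The states `(S_i, R_i)` when the value `w i` is selected at time `i` if and only if it lies in
`[a i S_{i-1} R_{i-1}, b i S_{i-1} R_{i-1}]`. -/
def state (a b : ℕ → ℝ → Fin 2 → ℝ) (w : ℕ → ℝ) : ℕ → ℝ × Fin 2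
  | 0 => (0, 0)
  | i + 1 =>
      let p := state a b w i
      if w (i + 1) ∈ Set.Icc (a (i + 1) p.1 p.2) (b (i + 1) p.1 p.2) then
        (w (i + 1), if w (i + 1) < p.1 then 1 else p.2)
      else p

/-- The interval policy with thresholds `a`, `b`. The states and the thresholds live on the scale of
the values `F (X i)`, where `F` is the common distribution function. -/
def intervalPolicy {Ω : Type*} (a b : ℕ → ℝ → Fin 2 → ℝ) (F : ℝ → ℝ) (X : ℕ → Ω → ℝ) :
    ℕ → Set Ω :=
  fun i => {ω |
    let p := state a b (fun j => F (X j ω)) (i - 1)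
    F (X i ω) ∈ Set.Icc (a i p.1 p.2) (b i p.1 p.2)}

/-- The lower threshold `a*(i, s, r) = inf {x ∈ [0, s] : v_{i+1}(s, r) ≤ 1 + v_{i+1}(x, 1)}`. The
infimum is taken in the interval `[0, s]`, so that it is `s` when no such `x` exists; adding the
point `s` to the set has exactly this effect. -/
def lowerThreshold (n i : ℕ) (s : ℝ) (r : Fin 2) : ℝ :=
  sInf (insert s {x ∈ Set.Icc 0 s | value n (i + 1) s r ≤ 1 + value n (i + 1) x 1})

/-- The upper threshold: `b*(i, s, 0) = sup {x ∈ [s, 1] : v_{i+1}(s, 0) ≤ 1 + v_{i+1}(x, 0)}` and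
`b*(i, s, 1) = s`. -/
def upperThreshold (n i : ℕ) (s : ℝ) (r : Fin 2) : ℝ :=
  if r = 0 then sSup {x ∈ Set.Icc s 1 | value n (i + 1) s 0 ≤ 1 + value n (i + 1) x 0} else s

/-- The expected number of selections from time `i` on, in the state `(s, r)`, when one accepts the
uniformly distributed observation at time `i` if it lies in `[a, b]` (where `a ≤ s ≤ b`), and goes
on optimally. -/
def intervalReward (n i : ℕ) (s : ℝ) (r : Fin 2) (a b : ℝ) : ℝ :=
  (1 - (b - a)) * value n (i + 1) s r + (∫ x in a..s, (1 + value n (i + 1) x 1)) +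
    ∫ x in s..b, (1 + value n (i + 1) x 0)

end

end UnimodalSelection

open UnimodalSelection

/-!
The proof is a verification by dynamic programming; the only analytic ingredient is the monotonicity
of the value function.

*Value function.* Write `V m s r = valueToGo m s r`. Raising the last value of a decreasing sequence
from `s` to `t` gains at least `t - s` (`sub_le_valueToGo_one_sub`), so `V m · 1` is strictly
increasing for `m ≥ 1`. At the top of the scale both phases agree (`valueToGo_top`). Hence
`V m · 0 ≥ V m 1 0 = V m 1 1 ≥ V m · 1` once `V m · 0` is known to be antitone, and this comparison
makes `V (m + 1) · 0` antitone, and strictly so for `m ≥ 1` (`integral_le_valueToGo_zero_sub`). By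
monotonicity the values whose selection is at least as good as the alternative form exactly the
interval between the two thresholds (`mem_Icc_thresholds_iff`), and by strict monotonicity ties
occur for at most two values (`finite_ties`). The latter also makes the
thresholds the only place at which to cut the integrals in the Bellman equation
(`value_eq_intervalReward_iff`).

*Feasibility.* The state `(s, r)` holds all that matters about the past: a set of selections is
unimodal (or decreasing) if and only if each selection is allowed by the state in which it is made
(`isPhaseOn_iff_selectable`).

*Verification.* The variables `F (X i)` are uniformly distributed on `[0, 1]`
(`map_comp_cdf_eq_uniform`), and each is independent of the history before it, hence of the state it
meets. By Fubini's theorem, the expected number of selections of any non-anticipating policy equals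
the value of its initial state minus the sum of the expected losses of its decisions against the
Bellman equation (`integral_numSelected_add_sum_loss`). The losses are almost surely nonnegative for
a feasible policy, and they vanish for the threshold policy, which is therefore optimal. If a
feasible policy is optimal, each of its losses vanishes almost surely; as ties have probability
zero, it decides like the thresholds in its own states, and so, by induction on time, it is the
threshold policy (`IsAllowed.ae_followsThresholds`, `followsThresholds_iff`).

Finally, the state `(0, 0)` imposes no restriction on the first selection, and `F` almost surely
keeps the observations apart, so that unimodality of the selected `X i` is the same as unimodality
on the scale of `F` after the initial value `0` (`mem_policies_iff`).
-/

namespace UnimodalSelection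

/-! ### The value function -/

lemma valueToGo_succ_zero (m : ℕ) (s : ℝ) :
    valueToGo (m + 1) s 0 = (∫ x in (0 : ℝ)..s, max (valueToGo m s 0) (1 + valueToGo m x 1)) +
      ∫ x in s..1, max (valueToGo m s 0) (1 + valueToGo m x 0) := by
  simp [valueToGo]

lemma valueToGo_succ_one (m : ℕ) (s : ℝ) :
    valueToGo (m + 1) s 1 = (1 - s) * valueToGo m s 1 +
      ∫ x in (0 : ℝ)..s, max (valueToGo m s 1) (1 + valueToGo m x 1) := by
  simp [valueToGo]

lemma continuous_valueToGo (m : ℕ) (r : Fin 2) : Continuous fun s => valueToGo m s r := by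
  induction m generalizing r with
  | zero => exact continuous_const
  | succ m ih =>
    have h0 := ih 0
    have h1 := ih 1
    have aux (r q : Fin 2) (c : ℝ) : Continuous fun s : ℝ =>
        ∫ x in c..s, max (valueToGo m s r) (1 + valueToGo m x q) := by
      have hr := ih r
      have hq := ih q
      refine intervalIntegral.continuous_parametric_intervalIntegral_of_continuous ?_ continuous_id
      fun_prop
    rcases Fin.exists_fin_two.mp ⟨r, rfl⟩ with rfl | rfl
    · simp_rw [valueToGo_succ_zero]
      refine (aux 0 1 0).add ?_
      simp_rw [intervalIntegral.integral_symm (1 : ℝ)]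
      exact (aux 0 0 1).neg
    · simp_rw [valueToGo_succ_one]
      exact ((continuous_const.sub continuous_id).mul h1).add (aux 1 1 0)

@[fun_prop]
lemma continuous_valueToGo_comp {Y : Type*} [TopologicalSpace Y] (m : ℕ) (r : Fin 2) {f : Y → ℝ}
    (hf : Continuous f) : Continuous fun y => valueToGo m (f y) r :=
  (continuous_valueToGo m r).comp hf

/-- After the turning point, every additional bit of room below the last selected value is worth
something: in the next step an observation in `[s, t]` can be selected from `t` but not from `s`. -/
lemma sub_le_valueToGo_one_sub (m : ℕ) {s t : ℝ} (hs : 0 ≤ s) (hst : s ≤ t) (ht : t ≤ 1) :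
    t - s ≤ valueToGo (m + 1) t 1 - valueToGo (m + 1) s 1 := by
  induction m generalizing s t with
  | zero => simp [valueToGo]
  | succ m ih =>
    have mono : ∀ x ∈ Set.Icc (0 : ℝ) 1, ∀ y ∈ Set.Icc (0 : ℝ) 1, x ≤ y →
        valueToGo (m + 1) x 1 ≤ valueToGo (m + 1) y 1 := fun x hx y hy hxy => by
      linarith [ih hx.1 hxy hy.2]
    rw [valueToGo_succ_one (m + 1) t, valueToGo_succ_one (m + 1) s]
    generalize hV : (fun x => valueToGo (m + 1) x 1) = V at mono
    have hc : Continuous V := hV ▸ continuous_valueToGo _ _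
    have hV' : ∀ x, valueToGo (m + 1) x 1 = V x := fun x => by rw [← hV]
    simp only [hV'] at mono ⊢
    have i1 : ∀ a b c, IntervalIntegrable (fun x => max (V a) (1 + V x)) volume b c :=
      fun a b c => Continuous.intervalIntegrable (by fun_prop) _ _
    rw [← intervalIntegral.integral_add_adjacent_intervals (i1 t 0 s) (i1 t s t)]
    have hst' := mono s ⟨hs, by linarith⟩ t ⟨by linarith, ht⟩ hst
    have e1 : ∫ x in (0 : ℝ)..s, max (V s) (1 + V x) ≤ ∫ x in (0 : ℝ)..s, max (V t) (1 + V x) :=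
      intervalIntegral.integral_mono_on hs (i1 _ _ _) (i1 _ _ _) fun x _ => max_le_max hst' le_rfl
    have e2 : ∫ x in s..t, (1 + V s) ≤ ∫ x in s..t, max (V t) (1 + V x) :=
      intervalIntegral.integral_mono_on hst (by simp) (i1 _ _ _) fun x hx =>
        le_max_of_le_right (by
          linarith [mono s ⟨hs, by linarith⟩ x ⟨by linarith [hx.1], by linarith [hx.2]⟩ hx.1])
    rw [intervalIntegral.integral_const, smul_eq_mul] at e2
    nlinarith

lemma strictMonoOn_valueToGo_one {m : ℕ} (hm : m ≠ 0) :
    StrictMonoOn (fun s => valueToGo m s 1) (Set.Icc 0 1) := by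
  obtain ⟨m, rfl⟩ := Nat.exists_eq_succ_of_ne_zero hm
  intro s hs t ht hst
  have := sub_le_valueToGo_one_sub m hs.1 hst.le ht.2
  dsimp only
  linarith

lemma monotoneOn_valueToGo_one (m : ℕ) : MonotoneOn (fun s => valueToGo m s 1) (Set.Icc 0 1) := by
  rcases eq_or_ne m 0 with rfl | hm
  · simpa [valueToGo] using monotoneOn_const
  · exact (strictMonoOn_valueToGo_one hm).monotoneOn

/-- At the top of the scale there is no room to increase any further. -/
lemma valueToGo_top (m : ℕ) : valueToGo m 1 0 = valueToGo m 1 1 := by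
  induction m with
  | zero => rfl
  | succ m ih => simp [valueToGo_succ_zero, valueToGo_succ_one, ih]

/-- Raising the last selected value of an increasing sequence from `s` to `t` costs the option to go
on increasing when the next observation falls in `[s, t]`. -/
lemma integral_le_valueToGo_zero_sub (m : ℕ) (hm : AntitoneOn (fun s => valueToGo m s 0)
    (Set.Icc 0 1)) {s t : ℝ} (hs : 0 ≤ s) (hst : s ≤ t) (ht : t ≤ 1) :
    (∫ x in s..t, min 1 (valueToGo m x 0 - valueToGo m x 1)) ≤
      valueToGo (m + 1) s 0 - valueToGo (m + 1) t 0 := by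
  rw [valueToGo_succ_zero m t, valueToGo_succ_zero m s]
  have i1 : ∀ a b c r q, IntervalIntegrable (fun x => max (valueToGo m a r) (1 + valueToGo m x q))
      volume b c := fun a b c r q => Continuous.intervalIntegrable (by fun_prop) _ _
  have i2 : ∀ b c, IntervalIntegrable (fun x => min 1 (valueToGo m x 0 - valueToGo m x 1))
      volume b c := fun b c => Continuous.intervalIntegrable (by fun_prop) _ _
  rw [← intervalIntegral.integral_add_adjacent_intervals (i1 t 0 s 0 1) (i1 t s t 0 1),
    ← intervalIntegral.integral_add_adjacent_intervals (i1 s s t 0 0) (i1 s t 1 0 0)]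
  have hst' : valueToGo m t 0 ≤ valueToGo m s 0 := hm ⟨hs, by linarith⟩ ⟨by linarith, ht⟩ hst
  have e1 : ∫ x in (0 : ℝ)..s, max (valueToGo m t 0) (1 + valueToGo m x 1) ≤
      ∫ x in (0 : ℝ)..s, max (valueToGo m s 0) (1 + valueToGo m x 1) :=
    intervalIntegral.integral_mono_on hs (i1 _ _ _ _ _) (i1 _ _ _ _ _)
      fun x _ => max_le_max hst' le_rfl
  have e2 : ∫ x in t..1, max (valueToGo m t 0) (1 + valueToGo m x 0) ≤
      ∫ x in t..1, max (valueToGo m s 0) (1 + valueToGo m x 0) :=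
    intervalIntegral.integral_mono_on ht (i1 _ _ _ _ _) (i1 _ _ _ _ _)
      fun x _ => max_le_max hst' le_rfl
  have e3 : ∫ x in s..t, (min 1 (valueToGo m x 0 - valueToGo m x 1) +
      max (valueToGo m t 0) (1 + valueToGo m x 1)) ≤
      ∫ x in s..t, max (valueToGo m s 0) (1 + valueToGo m x 0) := by
    refine intervalIntegral.integral_mono_on hst ((i2 _ _).add (i1 _ _ _ _ _)) (i1 _ _ _ _ _) ?_
    intro x hx
    have hx' : valueToGo m t 0 ≤ valueToGo m x 0 :=
      hm ⟨by linarith [hx.1], by linarith [hx.2]⟩ ⟨by linarith, ht⟩ hx.2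
    refine le_max_of_le_right ?_
    rcases max_cases (valueToGo m t 0) (1 + valueToGo m x 1) with h | h <;>
    linarith [min_le_left 1 (valueToGo m x 0 - valueToGo m x 1),
      min_le_right 1 (valueToGo m x 0 - valueToGo m x 1)]
  rw [intervalIntegral.integral_add (i2 _ _) (i1 _ _ _ _ _)] at e3
  linarith

/-- The option to go on increasing is worth something below the top of the scale. -/
lemma valueToGo_one_le_zero {m : ℕ} (hm : AntitoneOn (fun s => valueToGo m s 0) (Set.Icc 0 1))
    {x : ℝ} (hx : x ∈ Set.Icc (0 : ℝ) 1) : valueToGo m x 1 ≤ valueToGo m x 0 :=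
  calc valueToGo m x 1 ≤ valueToGo m 1 1 :=
        monotoneOn_valueToGo_one m hx (Set.right_mem_Icc.mpr zero_le_one) hx.2
    _ = valueToGo m 1 0 := (valueToGo_top m).symm
    _ ≤ valueToGo m x 0 := hm hx (Set.right_mem_Icc.mpr zero_le_one) hx.2

lemma antitoneOn_valueToGo_zero (m : ℕ) :
    AntitoneOn (fun s => valueToGo m s 0) (Set.Icc 0 1) := by
  induction m with
  | zero => simpa [valueToGo] using antitoneOn_const
  | succ m ih =>
    intro s hs t ht hst
    have h := integral_le_valueToGo_zero_sub m ih hs.1 hst ht.2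
    have : 0 ≤ ∫ x in s..t, min 1 (valueToGo m x 0 - valueToGo m x 1) :=
      intervalIntegral.integral_nonneg hst fun x hx => le_min zero_le_one
        (sub_nonneg.mpr (valueToGo_one_le_zero ih ⟨hs.1.trans hx.1, hx.2.trans ht.2⟩))
    dsimp only
    linarith

lemma strictAntiOn_valueToGo_zero {m : ℕ} (hm : 2 ≤ m) :
    StrictAntiOn (fun s => valueToGo m s 0) (Set.Icc 0 1) := by
  obtain ⟨m, rfl⟩ := Nat.exists_eq_add_of_le' hm
  intro s hs t ht hst
  have h := integral_le_valueToGo_zero_sub (m + 1) (antitoneOn_valueToGo_zero _) hs.1 hst.le ht.2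
  have : 0 < ∫ x in s..t, min 1 (valueToGo (m + 1) x 0 - valueToGo (m + 1) x 1) := by
    refine intervalIntegral.intervalIntegral_pos_of_pos_on
      (Continuous.intervalIntegrable (by fun_prop) _ _) (fun x hx => lt_min one_pos ?_) hst
    have hx' : x ∈ Set.Icc (0 : ℝ) 1 := ⟨hs.1.trans hx.1.le, hx.2.le.trans ht.2⟩
    have h1 : (1 : ℝ) ∈ Set.Icc (0 : ℝ) 1 := Set.right_mem_Icc.mpr zero_le_one
    have a1 : valueToGo (m + 1) x 1 < valueToGo (m + 1) 1 1 :=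
      strictMonoOn_valueToGo_one (by simp) hx' h1 (hx.2.trans_le ht.2)
    have a2 : valueToGo (m + 1) 1 0 ≤ valueToGo (m + 1) x 0 :=
      antitoneOn_valueToGo_zero (m + 1) hx' h1 hx'.2
    linarith [valueToGo_top (m + 1)]
  dsimp only
  linarith

/-! ### The thresholds -/

lemma value_succ {n i : ℕ} : value n (i + 1) = valueToGo (n - i) := by
  simp [value]

lemma lowerThreshold_mem (n i : ℕ) (s : ℝ) (r : Fin 2) :
    lowerThreshold n i s r ∈
      insert s {x ∈ Set.Icc 0 s | value n (i + 1) s r ≤ 1 + value n (i + 1) x 1} := by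
  refine IsCompact.sInf_mem ?_ (Set.insert_nonempty _ _)
  rw [value_succ]
  refine IsCompact.insert ?_ s
  exact isCompact_Icc.inter_right (isClosed_le continuous_const
    (continuous_const.add (continuous_valueToGo _ _)))

lemma upperThreshold_zero_mem (n i : ℕ) {s : ℝ} (hs : s ∈ Set.Icc (0 : ℝ) 1) :
    upperThreshold n i s 0 ∈
      {x ∈ Set.Icc s 1 | value n (i + 1) s 0 ≤ 1 + value n (i + 1) x 0} := by
  simp only [upperThreshold, if_true]
  refine IsCompact.sSup_mem ?_ ⟨s, Set.left_mem_Icc.mpr hs.2, by linarith⟩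
  rw [value_succ]
  exact isCompact_Icc.inter_right (isClosed_le continuous_const
    (continuous_const.add (continuous_valueToGo _ _)))

lemma upperThreshold_one (n i : ℕ) (s : ℝ) : upperThreshold n i s 1 = s := by
  simp [upperThreshold]

lemma isThresholds_lower_upper (n : ℕ) : IsThresholds n (lowerThreshold n) (upperThreshold n) where
  lower i _ s hs r := by
    rcases lowerThreshold_mem n i s r with h | h
    · exact ⟨hs.1.trans h.ge, h.le⟩
    · exact h.1
  upper_zero i _ s hs := (upperThreshold_zero_mem n i hs).1
  upper_one i _ s _ := upperThreshold_one n i s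

lemma lowerThreshold_le_iff {n i : ℕ} {s x : ℝ} {r : Fin 2} (hs : s ∈ Set.Icc (0 : ℝ) 1)
    (hx : 0 ≤ x) (hxs : x < s) :
    lowerThreshold n i s r ≤ x ↔ valueToGo (n - i) s r ≤ 1 + valueToGo (n - i) x 1 := by
  constructor
  · intro h
    have := lowerThreshold_mem n i s r
    rw [value_succ] at this
    rcases this with h' | h'
    · linarith
    · have : valueToGo (n - i) (lowerThreshold n i s r) 1 ≤ valueToGo (n - i) x 1 :=
        monotoneOn_valueToGo_one (n - i) ⟨h'.1.1, by linarith [hs.2]⟩ ⟨hx, by linarith [hs.2]⟩ h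
      linarith [h'.2]
  · intro h
    refine csInf_le ⟨0, ?_⟩ (Or.inr ⟨⟨hx, hxs.le⟩, by rwa [value_succ]⟩)
    rintro y (rfl | hy)
    · exact hs.1
    · exact hy.1.1

lemma le_upperThreshold_iff {n i : ℕ} {s x : ℝ} (hs : s ∈ Set.Icc (0 : ℝ) 1)
    (hx : x ≤ 1) (hxs : s ≤ x) :
    x ≤ upperThreshold n i s 0 ↔ valueToGo (n - i) s 0 ≤ 1 + valueToGo (n - i) x 0 := by
  constructor
  · intro h
    have h' := upperThreshold_zero_mem n i hs
    rw [value_succ] at h'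
    have : valueToGo (n - i) (upperThreshold n i s 0) 0 ≤ valueToGo (n - i) x 0 :=
        antitoneOn_valueToGo_zero (n - i) ⟨by linarith [hs.1], hx⟩ ⟨hs.1.trans h'.1.1, h'.1.2⟩ h
    linarith [h'.2]
  · intro h
    simp only [upperThreshold, if_true]
    exact le_csSup ⟨1, fun y hy => hy.1.2⟩ ⟨⟨hxs, hx⟩, by rwa [value_succ]⟩

/-- The state after the selection of `x` in the state `p`. -/
noncomputable def nextState (p : ℝ × Fin 2) (x : ℝ) : ℝ × Fin 2 := (x, if x < p.1 then 1 else p.2)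

/-- The value `x` may be selected in the state `p`. -/
def Selectable (p : ℝ × Fin 2) (x : ℝ) : Prop := p.2 = 0 ∨ x ≤ p.1

/-- The thresholds select exactly the values whose selection is at least as good as the
alternative. -/
lemma mem_Icc_thresholds_iff {n i : ℕ} {p : ℝ × Fin 2} {x : ℝ} (hp : p.1 ∈ Set.Icc (0 : ℝ) 1)
    (hx : x ∈ Set.Icc (0 : ℝ) 1) :
    x ∈ Set.Icc (lowerThreshold n i p.1 p.2) (upperThreshold n i p.1 p.2) ↔
      Selectable p x ∧ valueToGo (n - i) p.1 p.2 ≤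
        1 + valueToGo (n - i) (nextState p x).1 (nextState p x).2 := by
  obtain ⟨s, r⟩ := p
  simp only [Selectable, nextState, Set.mem_Icc] at hp ⊢
  have hl : lowerThreshold n i s r ≤ s := by
    rcases lowerThreshold_mem n i s r with h | h
    · exact h.le
    · exact h.1.2
  rcases lt_or_ge x s with hxs | hxs
  · rw [if_pos hxs, lowerThreshold_le_iff hp hx.1 hxs]
    have : s ≤ upperThreshold n i s r := by
      rcases Fin.exists_fin_two.mp ⟨r, rfl⟩ with rfl | rfl
      · exact (upperThreshold_zero_mem n i hp).1.1
      · exact (upperThreshold_one n i s).ge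
    exact ⟨fun h => ⟨Or.inr hxs.le, h.1⟩, fun h => ⟨h.2, hxs.le.trans this⟩⟩
  · rw [if_neg hxs.not_gt]
    rcases Fin.exists_fin_two.mp ⟨r, rfl⟩ with rfl | rfl
    · rw [le_upperThreshold_iff hp hx.2 hxs]
      simpa using fun _ => hl.trans hxs
    · rw [upperThreshold_one]
      constructor
      · rintro ⟨-, h⟩
        obtain rfl := le_antisymm h hxs
        exact ⟨Or.inr le_rfl, by linarith⟩
      · rintro ⟨h | h, -⟩
        · simp at h
        · exact ⟨hl.trans hxs, h⟩

/-- Selecting and not selecting are equally good for at most two values. -/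
lemma finite_ties (m : ℕ) {p : ℝ × Fin 2} (hp : p.1 ∈ Set.Icc (0 : ℝ) 1) :
    {x ∈ Set.Icc (0 : ℝ) 1 | Selectable p x ∧
      valueToGo m p.1 p.2 = 1 + valueToGo m (nextState p x).1 (nextState p x).2}.Finite := by
  obtain ⟨s, r⟩ := p
  simp only [Selectable, nextState] at hp ⊢
  have h1 :
      {x ∈ Set.Icc (0 : ℝ) 1 | x < s ∧ valueToGo m s r = 1 + valueToGo m x 1}.Subsingleton := by
    rintro x ⟨hx, hxs, hxe⟩ y ⟨hy, hys, hye⟩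
    rcases eq_or_ne m 0 with rfl | hm
    · norm_num [valueToGo] at hxe
    · exact (strictMonoOn_valueToGo_one hm).injOn hx hy (by linarith)
  have h2 :
      {x ∈ Set.Icc (0 : ℝ) 1 | s ≤ x ∧ valueToGo m s 0 = 1 + valueToGo m x 0}.Subsingleton := by
    rintro x ⟨hx, hxs, hxe⟩ y ⟨hy, hys, hye⟩
    rcases lt_or_ge m 2 with hm | hm
    · interval_cases m <;> norm_num [valueToGo] at hxe
    · exact (strictAntiOn_valueToGo_zero hm).injOn hx hy (by linarith)
  refine (h1.finite.union h2.finite).subset ?_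
  rintro x ⟨hx, hsel, he⟩
  rcases lt_or_ge x s with hxs | hxs
  · rw [if_pos hxs] at he
    exact Or.inl ⟨hx, hxs, he⟩
  · rw [if_neg hxs.not_gt] at he
    rcases Fin.exists_fin_two.mp ⟨r, rfl⟩ with rfl | rfl
    · exact Or.inr ⟨hx, hxs, he⟩
    · obtain rfl : x = s := le_antisymm (by simpa using hsel) hxs
      linarith

/-! ### Uniqueness of the thresholds -/

/-- If a continuous function is negative before `c` and positive after `c`, then cutting at `c` is
the only way to integrate its positive part. -/
lemma integral_le_max_and_eq_iff_of_neg_pos {g : ℝ → ℝ} (hg : Continuous g) {l c u a : ℝ}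
    (hlc : l ≤ c) (hcu : c ≤ u) (hneg : ∀ x ∈ Set.Ico l c, g x < 0)
    (hpos : ∀ x ∈ Set.Ioo c u, 0 < g x) (ha : a ∈ Set.Icc l u) :
    (∫ x in a..u, g x) ≤ (∫ x in l..u, max 0 (g x)) ∧
      ((∫ x in a..u, g x) = (∫ x in l..u, max 0 (g x)) ↔ a = c) := by
  have i1 : ∀ b c, IntervalIntegrable g volume b c := fun b c => hg.intervalIntegrable _ _
  have i2 : ∀ b c, IntervalIntegrable (fun x => max 0 (g x)) volume b c :=
    fun b c => Continuous.intervalIntegrable (by fun_prop) _ _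
  have e1 : ∫ x in l..c, max 0 (g x) = 0 := by
    rw [intervalIntegral.integral_congr_ae (g := fun _ => 0), intervalIntegral.integral_zero]
    filter_upwards [Measure.ae_ne volume c] with x hxc hx
    rw [Set.uIoc_of_le hlc] at hx
    exact max_eq_left (hneg x ⟨hx.1.le, lt_of_le_of_ne hx.2 hxc⟩).le
  have e2 : ∫ x in c..u, max 0 (g x) = ∫ x in c..u, g x := by
    refine intervalIntegral.integral_congr_ae ?_
    filter_upwards [Measure.ae_ne volume u] with x hxu hx
    rw [Set.uIoc_of_le hcu] at hx
    exact max_eq_right (hpos x ⟨hx.1, lt_of_le_of_ne hx.2 hxu⟩).le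
  rw [← intervalIntegral.integral_add_adjacent_intervals (i2 l c) (i2 c u), e1, e2, zero_add,
    ← intervalIntegral.integral_add_adjacent_intervals (i1 a c) (i1 c u)]
  rcases lt_trichotomy a c with h | rfl | h
  · have : 0 < ∫ x in a..c, -g x := intervalIntegral.intervalIntegral_pos_of_pos_on (i1 a c).neg
      (fun x hx => neg_pos.mpr (hneg x ⟨ha.1.trans hx.1.le, hx.2⟩)) h
    rw [intervalIntegral.integral_neg] at this
    exact ⟨by linarith, fun h' => by linarith, fun h' => by linarith⟩
  · simp
  · have : 0 < ∫ x in c..a, g x := intervalIntegral.intervalIntegral_pos_of_pos_on (i1 c a)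
      (fun x hx => hpos x ⟨hx.1, hx.2.trans_le ha.2⟩) h
    rw [intervalIntegral.integral_symm c a]
    exact ⟨by linarith, fun h' => by linarith, fun h' => by linarith⟩

/-- The mirror image of `integral_le_max_and_eq_iff_of_neg_pos`. -/
lemma integral_le_max_and_eq_iff_of_pos_neg {g : ℝ → ℝ} (hg : Continuous g) {l c u b : ℝ}
    (hlc : l ≤ c) (hcu : c ≤ u) (hpos : ∀ x ∈ Set.Ioo l c, 0 < g x)
    (hneg : ∀ x ∈ Set.Ioc c u, g x < 0) (hb : b ∈ Set.Icc l u) :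
    (∫ x in l..b, g x) ≤ (∫ x in l..u, max 0 (g x)) ∧
      ((∫ x in l..b, g x) = (∫ x in l..u, max 0 (g x)) ↔ b = c) := by
  have h := integral_le_max_and_eq_iff_of_neg_pos (g := fun x => g (-x)) (by fun_prop)
    (neg_le_neg hcu) (neg_le_neg hlc)
    (fun x hx => hneg (-x) ⟨lt_neg_of_lt_neg hx.2, neg_le.mp hx.1⟩)
    (fun x hx => hpos (-x) ⟨lt_neg_of_lt_neg hx.2, neg_lt.mp hx.1⟩)
    (a := -b) ⟨neg_le_neg hb.2, neg_le_neg hb.1⟩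
  rw [intervalIntegral.integral_comp_neg (fun x => g x),
    intervalIntegral.integral_comp_neg (fun x => max 0 (g x))] at h
  simpa using h

lemma valueToGo_succ_zero_eq_add (m : ℕ) (s : ℝ) :
    valueToGo (m + 1) s 0 = valueToGo m s 0 +
      (∫ x in (0 : ℝ)..s, max 0 (1 + valueToGo m x 1 - valueToGo m s 0)) +
      ∫ x in s..1, max 0 (1 + valueToGo m x 0 - valueToGo m s 0) := by
  have h : ∀ c y : ℝ, max c y = c + max 0 (y - c) := fun c y => by
    rw [← max_add_add_left]
    simp
  rw [valueToGo_succ_zero]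
  simp_rw [h (valueToGo m s 0)]
  rw [intervalIntegral.integral_add, intervalIntegral.integral_add,
    intervalIntegral.integral_const, intervalIntegral.integral_const]
  · simp only [smul_eq_mul]
    ring
  all_goals exact Continuous.intervalIntegrable (by fun_prop) _ _

lemma valueToGo_succ_one_eq_add (m : ℕ) (s : ℝ) :
    valueToGo (m + 1) s 1 = valueToGo m s 1 +
      ∫ x in (0 : ℝ)..s, max 0 (1 + valueToGo m x 1 - valueToGo m s 1) := by
  have h : ∀ c y : ℝ, max c y = c + max 0 (y - c) := fun c y => by
    rw [← max_add_add_left]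
    simp
  rw [valueToGo_succ_one]
  simp_rw [h (valueToGo m s 1)]
  rw [intervalIntegral.integral_add, intervalIntegral.integral_const]
  · simp only [smul_eq_mul]
    ring
  all_goals exact Continuous.intervalIntegrable (by fun_prop) _ _

lemma intervalReward_eq_add (n i : ℕ) (s : ℝ) (r : Fin 2) (a b : ℝ) :
    intervalReward n i s r a b = valueToGo (n - i) s r +
      (∫ x in a..s, (1 + valueToGo (n - i) x 1 - valueToGo (n - i) s r)) +
      ∫ x in s..b, (1 + valueToGo (n - i) x 0 - valueToGo (n - i) s r) := by
  rw [intervalReward, value_succ, intervalIntegral.integral_sub, intervalIntegral.integral_sub,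
    intervalIntegral.integral_const, intervalIntegral.integral_const]
  · simp only [smul_eq_mul]
    ring
  all_goals exact Continuous.intervalIntegrable (by fun_prop) _ _

lemma valueToGo_lt_of_lowerThreshold_lt {n i : ℕ} {s x : ℝ} {r : Fin 2}
    (hs : s ∈ Set.Icc (0 : ℝ) 1) (hx : x ∈ Set.Ioo (lowerThreshold n i s r) s) :
    0 < 1 + valueToGo (n - i) x 1 - valueToGo (n - i) s r := by
  rcases eq_or_ne (n - i) 0 with hm | hm
  · simp [hm, valueToGo]
  have h0 : 0 ≤ lowerThreshold n i s r := by
    rcases lowerThreshold_mem n i s r with h | h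
    · exact hs.1.trans h.ge
    · exact h.1.1
  -- the gain is nonnegative at a point below `x` already, and it increases strictly
  obtain ⟨y, hy1, hy2⟩ := exists_between hx.1
  have h1 := (lowerThreshold_le_iff hs (h0.trans hy1.le) (hy2.trans hx.2)).mp hy1.le
  have h2 : valueToGo (n - i) y 1 < valueToGo (n - i) x 1 :=
    strictMonoOn_valueToGo_one hm ⟨h0.trans hy1.le, by linarith [hx.2, hs.2]⟩
      ⟨h0.trans hx.1.le, hx.2.le.trans hs.2⟩ hy2
  linarith

lemma valueToGo_lt_of_lt_upperThreshold {n i : ℕ} {s x : ℝ}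
    (hs : s ∈ Set.Icc (0 : ℝ) 1) (hx : x ∈ Set.Ioo s (upperThreshold n i s 0)) :
    0 < 1 + valueToGo (n - i) x 0 - valueToGo (n - i) s 0 := by
  rcases lt_or_ge (n - i) 2 with hm | hm
  · generalize n - i = m at hm
    interval_cases m <;> simp [valueToGo]
  have h0 : upperThreshold n i s 0 ≤ 1 := (upperThreshold_zero_mem n i hs).1.2
  obtain ⟨y, hy1, hy2⟩ := exists_between hx.2
  have h1 := (le_upperThreshold_iff hs (hy2.le.trans h0) (hx.1.trans hy1).le).mp hy2.le
  have h2 : valueToGo (n - i) y 0 < valueToGo (n - i) x 0 :=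
    strictAntiOn_valueToGo_zero hm ⟨hs.1.trans hx.1.le, by linarith⟩
      ⟨by linarith [hs.1, hx.1], by linarith⟩ hy1
  linarith

lemma value_eq_intervalReward_iff {n i : ℕ} (hi : i ≤ n) {s : ℝ} (hs : s ∈ Set.Icc (0 : ℝ) 1)
    {r : Fin 2} {a b : ℝ} (ha : a ∈ Set.Icc 0 s) (hb0 : r = 0 → b ∈ Set.Icc s 1)
    (hb1 : r = 1 → b = s) :
    value n i s r = intervalReward n i s r a b ↔
      a = lowerThreshold n i s r ∧ b = upperThreshold n i s r := by
  have hv : value n i = valueToGo (n - i + 1) := by rw [value, Nat.sub_add_comm hi]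
  rw [hv, intervalReward_eq_add]
  have hl : lowerThreshold n i s r ∈ Set.Icc 0 s := by
    rcases lowerThreshold_mem n i s r with h | h
    · exact ⟨hs.1.trans h.ge, h.le⟩
    · exact h.1
  obtain ⟨l1, l2⟩ := integral_le_max_and_eq_iff_of_neg_pos
    (g := fun x => 1 + valueToGo (n - i) x 1 - valueToGo (n - i) s r) (by fun_prop) hl.1 hl.2
    (fun x hx => by
      have := (lowerThreshold_le_iff hs hx.1 (hx.2.trans_le hl.2)).not.mp hx.2.not_ge
      linarith)
    (fun x hx => valueToGo_lt_of_lowerThreshold_lt hs hx) ha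
  rcases Fin.exists_fin_two.mp ⟨r, rfl⟩ with rfl | rfl
  · have hu := (upperThreshold_zero_mem n i hs).1
    obtain ⟨u1, u2⟩ := integral_le_max_and_eq_iff_of_pos_neg
      (g := fun x => 1 + valueToGo (n - i) x 0 - valueToGo (n - i) s 0) (by fun_prop) hu.1 hu.2
      (fun x hx => valueToGo_lt_of_lt_upperThreshold hs hx)
      (fun x hx => by
        have := (le_upperThreshold_iff (n := n) (i := i) hs hx.2 (hu.1.trans hx.1.le)).not.mp
          hx.1.not_ge
        linarith) (hb0 rfl)
    rw [valueToGo_succ_zero_eq_add, ← l2, ← u2]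
    exact ⟨fun h => ⟨by linarith, by linarith⟩, fun h => by rw [h.1, h.2]⟩
  · rw [valueToGo_succ_one_eq_add, ← l2, hb1 rfl, upperThreshold_one]
    simp [eq_comm]

/-! ### Feasibility in terms of states -/

/-- The state at time `j` when the values `w j`, `j ∈ T`, are selected, starting from `p`. -/
noncomputable def trackState (p : ℝ × Fin 2) (w : ℕ → ℝ) (T : Set ℕ) : ℕ → ℝ × Fin 2
  | 0 => p
  | j + 1 => open scoped Classical in
      if j + 1 ∈ T then nextState (trackState p w T j) (w (j + 1)) else trackState p w T j

lemma trackState_succ_of_mem {p : ℝ × Fin 2} {w : ℕ → ℝ} {T : Set ℕ} {j : ℕ} (h : j + 1 ∈ T) :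
    trackState p w T (j + 1) = nextState (trackState p w T j) (w (j + 1)) := by
  simp [trackState, h]

lemma trackState_succ_of_notMem {p : ℝ × Fin 2} {w : ℕ → ℝ} {T : Set ℕ} {j : ℕ} (h : j + 1 ∉ T) :
    trackState p w T (j + 1) = trackState p w T j := by
  simp [trackState, h]

lemma trackState_of_le {p : ℝ × Fin 2} {w : ℕ → ℝ} {T : Set ℕ} {k j : ℕ} (hT : ∀ i ∈ T, k < i)
    (hj : j ≤ k) : trackState p w T j = p := by
  induction j with
  | zero => rfl
  | succ j ih =>
    rw [trackState_succ_of_notMem fun h => by have := hT _ h; omega, ih (by omega)]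

/-- The sequence with index set `T` is of the type asked for in the phase `r`: unimodal if `r = 0`,
and decreasing if `r = 1`. -/
def IsPhaseOn (x : ℕ → ℝ) (T : Set ℕ) (r : Fin 2) : Prop :=
  if r = 0 then IsUnimodalOn x T else AntitoneOn x T

lemma insert_sep_le_self {T : Set ℕ} {k : ℕ} (hT : ∀ i ∈ T, k < i) :
    insert k {i ∈ T | i ≤ k} = {k} := by
  ext i
  simp only [Set.mem_insert_iff, Set.mem_ofPred_eq, Set.mem_singleton_iff, or_iff_left_iff_imp]
  intro h
  have := hT i h.1
  omega

lemma insert_sep_le_succ {T : Set ℕ} {k j : ℕ} (hj : j + 1 ∈ T) :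
    insert k {i ∈ T | i ≤ j + 1} = insert (j + 1) (insert k {i ∈ T | i ≤ j}) := by
  ext i
  simp only [Set.mem_insert_iff, Set.mem_ofPred_eq]
  constructor
  · rintro (h | ⟨h1, h2⟩)
    · tauto
    · rcases Nat.le_succ_iff.mp h2 with h | h <;> tauto
  · rintro (rfl | h | h)
    · tauto
    · tauto
    · exact Or.inr ⟨h.1, by omega⟩

lemma sep_le_succ_of_notMem {T : Set ℕ} {j : ℕ} (hj : j + 1 ∉ T) :
    {i ∈ T | i ≤ j + 1} = {i ∈ T | i ≤ j} := by
  ext i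
  simp only [Set.mem_ofPred_eq, and_congr_right_iff]
  intro hi
  have : i ≠ j + 1 := fun h => hj (h ▸ hi)
  omega

/-- A decreasing sequence may be continued below its last value. -/
lemma antitoneOn_insert_of_le {x : ℕ → ℝ} {S : Set ℕ} {l m : ℕ} (hS : AntitoneOn x S)
    (hl : l ∈ S) (hmax : ∀ i ∈ S, i ≤ l) (hlm : l < m) (hx : x m ≤ x l) :
    AntitoneOn x (insert m S) := by
  rintro a (rfl | ha) b (rfl | hb) hab
  · exact le_rfl
  · exact absurd ((hmax b hb).trans_lt hlm) hab.not_gt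
  · exact hx.trans (hS ha hl (hmax a ha))
  · exact hS ha hb hab

/-- An increasing sequence may be continued above its last value. -/
lemma monotoneOn_insert_of_le {x : ℕ → ℝ} {S : Set ℕ} {l m : ℕ} (hS : MonotoneOn x S)
    (hl : l ∈ S) (hmax : ∀ i ∈ S, i ≤ l) (hlm : l < m) (hx : x l ≤ x m) :
    MonotoneOn x (insert m S) := by
  have := antitoneOn_insert_of_le (x := fun i => -x i) hS.neg hl hmax hlm (neg_le_neg hx)
  simpa using this.neg

/-- The state remembers the last selected value, and its second component is `1` as soon as there
has been a descent. -/
lemma trackState_spec {p : ℝ × Fin 2} {w : ℕ → ℝ} {T : Set ℕ} {k : ℕ} (hT : ∀ i ∈ T, k < i)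
    {x : ℕ → ℝ} (hxk : x k = p.1) (hx : ∀ i ∈ T, x i = w i) {j : ℕ} (hj : k ≤ j) :
    ∃ l ∈ insert k {i ∈ T | i ≤ j}, l ≤ j ∧ (∀ i ∈ insert k {i ∈ T | i ≤ j}, i ≤ l) ∧
      (trackState p w T j).1 = x l ∧
      ((trackState p w T j).2 = 0 → p.2 = 0 ∧ MonotoneOn x (insert k {i ∈ T | i ≤ j})) ∧
      ((trackState p w T j).2 = 1 → p.2 = 1 ∨ ∃ a ∈ insert k {i ∈ T | i ≤ j},
        ∃ b ∈ insert k {i ∈ T | i ≤ j}, a < b ∧ x b < x a) := by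
  induction j, hj using Nat.le_induction with
  | base =>
    rw [insert_sep_le_self hT, trackState_of_le hT le_rfl]
    refine ⟨k, rfl, le_rfl, fun i hi => (Set.mem_singleton_iff.mp hi).le, hxk.symm,
      fun h => ⟨h, ?_⟩, fun h => Or.inl h⟩
    exact Set.subsingleton_singleton.monotoneOn _
  | succ j hj ih =>
    by_cases hjT : j + 1 ∈ T
    · rw [insert_sep_le_succ hjT, trackState_succ_of_mem hjT]
      obtain ⟨l, hl, -, hmax, hval, h0, h1⟩ := ih
      have hlt : ∀ i ∈ insert k {i ∈ T | i ≤ j}, i < j + 1 := by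
        rintro i (rfl | h)
        · omega
        · have := h.2
          omega
      refine ⟨j + 1, Set.mem_insert _ _, le_rfl, ?_, (hx _ hjT).symm, ?_, ?_⟩
      · rintro i (rfl | hi)
        · rfl
        · exact (hlt i hi).le
      · intro h
        simp only [nextState, hval, ← hx _ hjT] at h
        split_ifs at h with hlt'
        · simp at h
        · obtain ⟨hp, hm⟩ := h0 h
          exact ⟨hp, monotoneOn_insert_of_le hm hl hmax (hlt l hl) (not_lt.mp hlt')⟩
      · intro h
        simp only [nextState, hval, ← hx _ hjT] at h
        split_ifs at h with hlt'
        · exact Or.inr ⟨l, Or.inr hl, j + 1, Or.inl rfl, hlt l hl, hlt'⟩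
        · refine (h1 h).imp_right ?_
          rintro ⟨a, ha, b, hb, hab⟩
          exact ⟨a, Or.inr ha, b, Or.inr hb, hab⟩
    · obtain ⟨l, hl, hlj, h⟩ := ih
      rw [sep_le_succ_of_notMem hjT, trackState_succ_of_notMem hjT]
      exact ⟨l, hl, by omega, h⟩

/-- A set of selections is feasible if and only if every single one of them is allowed by the state
in which it is made. -/
lemma isPhaseOn_iff_selectable {p : ℝ × Fin 2} {w : ℕ → ℝ} {T : Set ℕ} {k : ℕ}
    (hT : ∀ i ∈ T, k < i) {n : ℕ} (hTn : ∀ i ∈ T, i ≤ n) {x : ℕ → ℝ} (hxk : x k = p.1)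
    (hx : ∀ i ∈ T, x i = w i) :
    IsPhaseOn x (insert k T) p.2 ↔
      ∀ j, j + 1 ∈ T → Selectable (trackState p w T j) (w (j + 1)) := by
  have hsub : ∀ j, insert k {i ∈ T | i ≤ j} ⊆ insert k T :=
    fun j => Set.insert_subset_insert (Set.sep_subset _ _)
  constructor
  · intro h j hj
    have hkj : k ≤ j := Nat.lt_succ_iff.mp (hT _ hj)
    obtain ⟨l, hl, hlj', hmax, hval, -, h1⟩ := trackState_spec hT hxk hx hkj
    have hlj : l < j + 1 := Nat.lt_succ_of_le hlj'
    rw [Selectable, hval, ← hx _ hj]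
    rcases Fin.exists_fin_two.mp ⟨(trackState p w T j).2, rfl⟩ with hr | hr
    · exact Or.inl hr
    right
    rcases h1 hr with hp | ⟨a, ha, b, hb, hab, hlt⟩
    · simp only [IsPhaseOn, hp, Fin.isValue, one_ne_zero, if_false] at h
      exact h (hsub j hl) (Or.inr hj) hlj.le
    by_cases hp : p.2 = 0
    · simp only [IsPhaseOn, hp, if_true] at h
      rcases h with h | ⟨t, ht, hmono, hanti⟩
      · exact absurd h (Set.insert_nonempty _ _).ne_empty
      -- the descent from `a` to `b` lies after the turning place
      have htb : t < b := by
        by_contra! hbt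
        exact hlt.not_ge (hmono ⟨hsub j ha, hab.le.trans hbt⟩ ⟨hsub j hb, hbt⟩ hab.le)
      have htl := htb.trans_le (hmax b hb)
      exact hanti ⟨hsub j hl, htl.le⟩ ⟨Or.inr hj, (htl.trans hlj).le⟩ hlj.le
    · simp only [IsPhaseOn, hp, if_false] at h
      exact h (hsub j hl) (Or.inr hj) hlj.le
  · intro h
    -- feasibility of the selections up to time `j`, by induction on `j`
    have key : ∀ j, k ≤ j → IsPhaseOn x (insert k {i ∈ T | i ≤ j}) p.2 := by
      intro j hj
      induction j, hj using Nat.le_induction with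
      | base =>
        rw [insert_sep_le_self hT, IsPhaseOn]
        split_ifs
        · refine Or.inr ⟨k, rfl, ?_, ?_⟩
          · exact (Set.subsingleton_singleton.anti (Set.sep_subset _ _)).monotoneOn _
          · exact (Set.subsingleton_singleton.anti (Set.sep_subset _ _)).antitoneOn _
        · exact Set.subsingleton_singleton.antitoneOn _
      | succ j hj ih =>
        by_cases hjT : j + 1 ∈ T
        · obtain ⟨l, hl, hlj, hmax, hval, h0, -⟩ := trackState_spec hT hxk hx hj
          have hsel := h j hjT
          rw [Selectable, hval, ← hx _ hjT] at hsel
          have hlj' : l < j + 1 := Nat.lt_succ_of_le hlj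
          rw [insert_sep_le_succ hjT]
          -- a smaller value prolongs the decreasing part; a larger one is selected only while the
          -- sequence increases, and becomes the new turning place
          rcases le_or_gt (x (j + 1)) (x l) with hle | hlt
          · rw [IsPhaseOn] at ih ⊢
            split_ifs at ih ⊢ with hp
            · rcases ih with ih | ⟨t, ht, hmono, hanti⟩
              · exact absurd ih (Set.insert_nonempty _ _).ne_empty
              have htl := hmax t ht
              refine Or.inr ⟨t, Or.inr ht, hmono.mono ?_,
                (antitoneOn_insert_of_le hanti ⟨hl, htl⟩ (fun i hi => hmax i hi.1) hlj' hle).mono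
                  ?_⟩
              · rintro i ⟨rfl | hi, hit⟩
                · omega
                · exact ⟨hi, hit⟩
              · rintro i ⟨rfl | hi, hit⟩
                · exact Or.inl rfl
                · exact Or.inr ⟨hi, hit⟩
            · exact antitoneOn_insert_of_le ih hl hmax hlj' hle
          · obtain ⟨hp, hmono⟩ := h0 (hsel.resolve_right hlt.not_ge)
            rw [IsPhaseOn, if_pos hp]
            refine Or.inr ⟨j + 1, Or.inl rfl,
              (monotoneOn_insert_of_le hmono hl hmax hlj' hlt.le).mono (Set.sep_subset _ _), ?_⟩
            refine (Set.subsingleton_singleton (a := j + 1)).anti ?_ |>.antitoneOn _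
            rintro i ⟨rfl | hi, hit⟩
            · rfl
            · have := hmax i hi
              omega
        · rwa [sep_le_succ_of_notMem hjT]
    have hins : insert k {i ∈ T | i ≤ max k n} = insert k T := by
      congr 1
      exact Set.sep_eq_self_iff_mem_true.mpr fun i hi => (hTn i hi).trans (le_max_right _ _)
    exact hins ▸ key (max k n) (le_max_left _ _)

section

/-! ### One step of the dynamic program -/

lemma measurable_valueToGo (m : ℕ) :
    Measurable fun p : ℝ × Fin 2 => valueToGo m p.1 p.2 :=
  measurable_from_prod_countable_left fun r => (continuous_valueToGo m r).measurable

lemma measurable_nextState : Measurable fun q : (ℝ × Fin 2) × ℝ => nextState q.1 q.2 :=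
  measurable_snd.prodMk (Measurable.ite (measurableSet_lt measurable_snd measurable_fst.fst)
    measurable_const measurable_fst.snd)

lemma measurableSet_selectable : MeasurableSet {q : (ℝ × Fin 2) × ℝ | Selectable q.1 q.2} :=
  (measurable_fst.snd (measurableSet_singleton (0 : Fin 2))).union
    (measurableSet_le measurable_snd measurable_fst.fst)

open scoped Classical in
/-- The expected number of selections in the state `p` when the next observation is `x`, a selection
is made only if it is allowed and not worse than the alternative, and `m` further observations are
to come. -/
noncomputable def stepReward (m : ℕ) (p : ℝ × Fin 2) (x : ℝ) : ℝ :=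
  if Selectable p x then
    max (valueToGo m p.1 p.2) (1 + valueToGo m (nextState p x).1 (nextState p x).2)
  else valueToGo m p.1 p.2

lemma measurable_stepReward (m : ℕ) :
    Measurable fun q : (ℝ × Fin 2) × ℝ => stepReward m q.1 q.2 := by
  have h1 : Measurable fun q : (ℝ × Fin 2) × ℝ => valueToGo m q.1.1 q.1.2 :=
    (measurable_valueToGo m).comp measurable_fst
  have h2 := (measurable_valueToGo m).comp measurable_nextState
  exact Measurable.ite measurableSet_selectable (h1.max (h2.const_add 1)) h1

lemma integral_stepReward (m : ℕ) {p : ℝ × Fin 2} (hp : p.1 ∈ Set.Icc (0 : ℝ) 1) :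
    ∫ x in Set.Icc (0 : ℝ) 1, stepReward m p x = valueToGo (m + 1) p.1 p.2 := by
  obtain ⟨s, r⟩ := p
  dsimp only at hp ⊢
  rw [integral_Icc_eq_integral_Ioc, ← intervalIntegral.integral_of_le zero_le_one]
  have e1 : ∀ᵐ x, x ∈ Set.uIoc 0 s →
      stepReward m (s, r) x = max (valueToGo m s r) (1 + valueToGo m x 1) := by
    filter_upwards [Measure.ae_ne volume s] with x hxs hx
    rw [Set.uIoc_of_le hp.1] at hx
    have hlt := lt_of_le_of_ne hx.2 hxs
    simp [stepReward, Selectable, nextState, hlt, hlt.le]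
  have e2 : ∀ᵐ x, x ∈ Set.uIoc s 1 → stepReward m (s, r) x =
      if r = 0 then max (valueToGo m s r) (1 + valueToGo m x 0) else valueToGo m s r := by
    refine Filter.Eventually.of_forall fun x hx => ?_
    rw [Set.uIoc_of_le hp.2] at hx
    split_ifs with hr <;> simp [stepReward, Selectable, nextState, hx.1.not_gt, hx.1.not_ge, hr]
  have c1 : IntervalIntegrable (fun x => max (valueToGo m s r) (1 + valueToGo m x 1)) volume 0 s :=
    Continuous.intervalIntegrable (by fun_prop) _ _
  have c2 : IntervalIntegrable (fun x => if r = 0 then max (valueToGo m s r) (1 + valueToGo m x 0)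
      else valueToGo m s r) volume s 1 := by
    split_ifs
    · exact Continuous.intervalIntegrable (by fun_prop) _ _
    · exact intervalIntegrable_const
  rw [← intervalIntegral.integral_add_adjacent_intervals (b := s)
      (c1.congr_ae ?_) (c2.congr_ae ?_),
    intervalIntegral.integral_congr_ae e1, intervalIntegral.integral_congr_ae e2]
  · rcases Fin.exists_fin_two.mp ⟨r, rfl⟩ with rfl | rfl
    · simp [valueToGo_succ_zero]
    · simp [valueToGo_succ_one]
      ring
  · exact (ae_restrict_iff' measurableSet_uIoc).mpr (e1.mono fun x h hx => (h hx).symm)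
  · exact (ae_restrict_iff' measurableSet_uIoc).mpr (e2.mono fun x h hx => (h hx).symm)

lemma exists_abs_valueToGo_le (m : ℕ) :
    ∃ C, ∀ p : ℝ × Fin 2, p.1 ∈ Set.Icc (0 : ℝ) 1 → |valueToGo m p.1 p.2| ≤ C := by
  have h : ∀ r, ∃ C, ∀ s ∈ Set.Icc (0 : ℝ) 1, |valueToGo m s r| ≤ C := fun r =>
    isCompact_Icc.exists_bound_of_continuousOn (continuous_valueToGo m r).continuousOn
  choose C hC using h
  refine ⟨max (C 0) (C 1), fun p hp => (hC p.2 p.1 hp).trans ?_⟩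
  rcases Fin.exists_fin_two.mp ⟨p.2, rfl⟩ with hr | hr
  · exact hr ▸ le_max_left _ _
  · exact hr ▸ le_max_right _ _

lemma exists_abs_stepReward_le (m : ℕ) :
    ∃ C, ∀ p : ℝ × Fin 2, p.1 ∈ Set.Icc (0 : ℝ) 1 → ∀ x ∈ Set.Icc (0 : ℝ) 1,
      |stepReward m p x| ≤ C := by
  obtain ⟨C, hC⟩ := exists_abs_valueToGo_le m
  refine ⟨1 + C, fun p hp x hx => ?_⟩
  have h1 := abs_le.mp (hC p hp)
  have h2 := abs_le.mp (hC (nextState p x) hx)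
  rw [abs_le, stepReward]
  split_ifs
  · exact ⟨le_max_of_le_left (by linarith), max_le (by linarith) (by linarith)⟩
  · exact ⟨by linarith, by linarith⟩

/-! ### Independent uniform observations -/

/-- `U 1, …, U n` are uniformly distributed on `[0, 1]`, adapted to `ℋ`, and each of them is
independent of the history before it. -/
structure IsUniformSequence {Ω : Type*} [mΩ : MeasurableSpace Ω] (μ : Measure Ω)
    (ℋ : ℕ → MeasurableSpace Ω) (U : ℕ → Ω → ℝ) (n : ℕ) : Prop where
  mono : Monotone ℋ
  le : ∀ j ≤ n, ℋ j ≤ mΩ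
  measurable : ∀ j ∈ Set.Icc 1 n, Measurable[ℋ j] (U j)
  mem : ∀ j ∈ Set.Icc 1 n, ∀ ω, U j ω ∈ Set.Icc (0 : ℝ) 1
  indep : ∀ j < n, Indep (ℋ j) (MeasurableSpace.comap (U (j + 1)) inferInstance) μ
  map_eq : ∀ j ∈ Set.Icc 1 n, μ.map (U j) = volume.restrict (Set.Icc 0 1)

variable {Ω : Type*} [mΩ : MeasurableSpace Ω] {μ : Measure Ω} [IsProbabilityMeasure μ]
  {ℋ : ℕ → MeasurableSpace Ω} {U : ℕ → Ω → ℝ} {n : ℕ}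

lemma IsUniformSequence.map_prod_eq (hU : IsUniformSequence μ ℋ U n) {j : ℕ} (hj : j < n)
    {σ : Ω → ℝ × Fin 2} (hσ : Measurable[ℋ j] σ) :
    μ.map (fun ω => (σ ω, U (j + 1) ω)) = (μ.map σ).prod (volume.restrict (Set.Icc 0 1)) := by
  have hj' : j + 1 ∈ Set.Icc 1 n := ⟨by omega, hj⟩
  have hσ' : Measurable σ := hσ.mono (hU.le j hj.le) le_rfl
  have hU' : Measurable (U (j + 1)) := (hU.measurable _ hj').mono (hU.le _ hj) le_rfl
  have hind : IndepFun σ (U (j + 1)) μ :=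
    (IndepFun_iff_Indep _ _ _).mpr (indep_of_indep_of_le_left (hU.indep j hj) hσ.comap_le)
  rw [hind.map_prod_eq_prod_map_map hσ'.aemeasurable hU'.aemeasurable, hU.map_eq _ hj']

/-- The conditional expectation of the next step, given the past, is the solution of the Bellman
equation. -/
lemma IsUniformSequence.integral_stepReward (hU : IsUniformSequence μ ℋ U n) {j : ℕ} (hj : j < n)
    {σ : Ω → ℝ × Fin 2} (hσ : Measurable[ℋ j] σ) (hmem : ∀ ω, (σ ω).1 ∈ Set.Icc (0 : ℝ) 1)
    (m : ℕ) :
    Integrable (fun ω => stepReward m (σ ω) (U (j + 1) ω)) μ ∧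
      ∫ ω, stepReward m (σ ω) (U (j + 1) ω) ∂μ = ∫ ω, valueToGo (m + 1) (σ ω).1 (σ ω).2 ∂μ := by
  have hj' : j + 1 ∈ Set.Icc 1 n := ⟨by omega, hj⟩
  have hσ' : Measurable σ := hσ.mono (hU.le j hj.le) le_rfl
  have hU' : Measurable (U (j + 1)) := (hU.measurable _ hj').mono (hU.le _ hj) le_rfl
  have hpair : Measurable fun ω => (σ ω, U (j + 1) ω) := hσ'.prodMk hU'
  obtain ⟨C, hC⟩ := exists_abs_stepReward_le m
  have hint : Integrable (fun ω => stepReward m (σ ω) (U (j + 1) ω)) μ :=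
    Integrable.of_bound ((measurable_stepReward m).comp hpair).aestronglyMeasurable C
      (Filter.Eventually.of_forall fun ω => hC _ (hmem ω) _ (hU.mem _ hj' ω))
  refine ⟨hint, ?_⟩
  have hmeas := (measurable_stepReward m).aestronglyMeasurable
    (μ := μ.map fun ω => (σ ω, U (j + 1) ω))
  have hint' : Integrable (fun q : (ℝ × Fin 2) × ℝ => stepReward m q.1 q.2)
      (μ.map fun ω => (σ ω, U (j + 1) ω)) :=
    (integrable_map_measure hmeas hpair.aemeasurable).mpr hint
  rw [← integral_map (φ := fun ω => (σ ω, U (j + 1) ω))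
    (f := fun q : (ℝ × Fin 2) × ℝ => stepReward m q.1 q.2) hpair.aemeasurable hmeas]
  rw [hU.map_prod_eq hj hσ] at hint' ⊢
  rw [integral_prod _ hint', integral_map hσ'.aemeasurable
    hint'.integral_prod_left.aestronglyMeasurable]
  exact integral_congr_ae (Filter.Eventually.of_forall fun ω => by
    exact UnimodalSelection.integral_stepReward m (hmem ω))

/-- An event about the present observation that, in each state of the past, singles out only
finitely many values has probability zero. -/
lemma IsUniformSequence.ae_notMem (hU : IsUniformSequence μ ℋ U n) {j : ℕ} (hj : j < n)
    {σ : Ω → ℝ × Fin 2} (hσ : Measurable[ℋ j] σ) (hmem : ∀ ω, (σ ω).1 ∈ Set.Icc (0 : ℝ) 1)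
    {N : Set ((ℝ × Fin 2) × ℝ)} (hN : MeasurableSet N)
    (hnull : ∀ p : ℝ × Fin 2, p.1 ∈ Set.Icc (0 : ℝ) 1 →
      {x ∈ Set.Icc (0 : ℝ) 1 | (p, x) ∈ N}.Finite) :
    ∀ᵐ ω ∂μ, (σ ω, U (j + 1) ω) ∉ N := by
  have hj' : j + 1 ∈ Set.Icc 1 n := ⟨by omega, hj⟩
  have hσ' : Measurable σ := hσ.mono (hU.le j hj.le) le_rfl
  have hU' : Measurable (U (j + 1)) := (hU.measurable _ hj').mono (hU.le _ hj) le_rfl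
  have h : μ.map (fun ω => (σ ω, U (j + 1) ω)) N = 0 := by
    rw [hU.map_prod_eq hj hσ, Measure.measure_prod_null hN]
    refine (ae_map_iff hσ'.aemeasurable
      (measurable_measure_prodMk_left hN (measurableSet_singleton 0))).mpr ?_
    refine Filter.Eventually.of_forall fun ω => ?_
    change (volume.restrict (Set.Icc 0 1)) (Prod.mk (σ ω) ⁻¹' N) = 0
    rw [Measure.restrict_apply (measurable_prodMk_left hN), Set.inter_comm]
    exact (hnull _ (hmem ω)).measure_zero _
  rw [Measure.map_apply (hσ'.prodMk hU') hN] at h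
  exact measure_eq_zero_iff_ae_notMem.mp h

end

section

variable {Ω : Type*} {U : ℕ → Ω → ℝ} {n : ℕ}

/-! ### The loss of a policy against the Bellman equation -/

/-- The state at time `j` under the policy `A`, which is used from time `k + 1` to time `n`,
starting from `p`. -/
noncomputable def policyState (U : ℕ → Ω → ℝ) (n k : ℕ) (p : ℝ × Fin 2) (A : ℕ → Set Ω) (j : ℕ)
    (ω : Ω) : ℝ × Fin 2 :=
  trackState p (fun i => U i ω) {i ∈ Set.Icc (k + 1) n | ω ∈ A i} j

/-- How much worse than the best allowed decision the decision of `A` at time `j + 1` is, when play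
is optimal afterwards. A selection that is not allowed may have a negative loss. -/
noncomputable def loss (U : ℕ → Ω → ℝ) (n k : ℕ) (p : ℝ × Fin 2) (A : ℕ → Set Ω) (j : ℕ)
    (ω : Ω) : ℝ :=
  stepReward (n - (j + 1)) (policyState U n k p A j ω) (U (j + 1) ω) -
    ((A (j + 1)).indicator (fun _ => (1 : ℝ)) ω +
      valueToGo (n - (j + 1)) (policyState U n k p A (j + 1) ω).1
        (policyState U n k p A (j + 1) ω).2)

variable {k : ℕ} {p : ℝ × Fin 2} {A : ℕ → Set Ω}

lemma policyState_of_le {j : ℕ} (hj : j ≤ k) (ω : Ω) : policyState U n k p A j ω = p :=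
  trackState_of_le (fun _ hi => hi.1.1) hj

lemma policyState_succ_of_mem {j : ℕ} (hj : j + 1 ∈ Set.Icc (k + 1) n) {ω : Ω}
    (hω : ω ∈ A (j + 1)) :
    policyState U n k p A (j + 1) ω = nextState (policyState U n k p A j ω) (U (j + 1) ω) :=
  trackState_succ_of_mem (T := {i ∈ Set.Icc (k + 1) n | ω ∈ A i}) ⟨hj, hω⟩

lemma policyState_succ_of_notMem {j : ℕ} {ω : Ω} (hω : ω ∉ A (j + 1)) :
    policyState U n k p A (j + 1) ω = policyState U n k p A j ω :=
  trackState_succ_of_notMem (T := {i ∈ Set.Icc (k + 1) n | ω ∈ A i}) fun h => hω h.2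

lemma policyState_mem (hU : ∀ j ∈ Set.Icc 1 n, ∀ ω, U j ω ∈ Set.Icc (0 : ℝ) 1)
    (hp : p.1 ∈ Set.Icc (0 : ℝ) 1) (j : ℕ) (ω : Ω) :
    (policyState U n k p A j ω).1 ∈ Set.Icc (0 : ℝ) 1 := by
  induction j with
  | zero => exact hp
  | succ j ih =>
    by_cases h : j + 1 ∈ Set.Icc (k + 1) n ∧ ω ∈ A (j + 1)
    · rw [policyState_succ_of_mem h.1 h.2]
      exact hU _ ⟨by omega, h.1.2⟩ ω
    · rwa [policyState, trackState_succ_of_notMem h]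

/-- A decision that is allowed has a nonnegative loss. -/
lemma loss_nonneg {j : ℕ} (hj : j + 1 ∈ Set.Icc (k + 1) n) {ω : Ω}
    (h : ω ∈ A (j + 1) → Selectable (policyState U n k p A j ω) (U (j + 1) ω)) :
    0 ≤ loss U n k p A j ω := by
  rw [loss, sub_nonneg, stepReward]
  by_cases hω : ω ∈ A (j + 1)
  · rw [policyState_succ_of_mem hj hω, if_pos (h hω), Set.indicator_of_mem hω]
    exact le_max_right _ _
  · rw [policyState_succ_of_notMem hω, Set.indicator_of_notMem hω, zero_add]
    split_ifs
    · exact le_max_left _ _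
    · exact le_rfl

/-- The decision of the thresholds has no loss. -/
lemma loss_eq_zero (hU : ∀ j ∈ Set.Icc 1 n, ∀ ω, U j ω ∈ Set.Icc (0 : ℝ) 1)
    (hp : p.1 ∈ Set.Icc (0 : ℝ) 1) {j : ℕ} (hj : j + 1 ∈ Set.Icc (k + 1) n) {ω : Ω}
    (h : ω ∈ A (j + 1) ↔ U (j + 1) ω ∈
      Set.Icc (lowerThreshold n (j + 1) (policyState U n k p A j ω).1 (policyState U n k p A j ω).2)
        (upperThreshold n (j + 1) (policyState U n k p A j ω).1 (policyState U n k p A j ω).2)) :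
    loss U n k p A j ω = 0 := by
  rw [mem_Icc_thresholds_iff (policyState_mem hU hp j ω) (hU _ ⟨by omega, hj.2⟩ ω)] at h
  rw [loss, sub_eq_zero, stepReward]
  by_cases hω : ω ∈ A (j + 1)
  · rw [policyState_succ_of_mem hj hω, if_pos (h.mp hω).1, Set.indicator_of_mem hω]
    exact max_eq_right (h.mp hω).2
  · rw [policyState_succ_of_notMem hω, Set.indicator_of_notMem hω, zero_add]
    split_ifs with hsel
    · exact max_eq_left (not_le.mp fun h' => hω (h.mpr ⟨hsel, h'⟩)).le
    · rfl

/-- A decision without loss is the decision of the thresholds, unless there is a tie. -/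
lemma mem_iff_of_loss_eq_zero (hU : ∀ j ∈ Set.Icc 1 n, ∀ ω, U j ω ∈ Set.Icc (0 : ℝ) 1)
    (hp : p.1 ∈ Set.Icc (0 : ℝ) 1) {j : ℕ} (hj : j + 1 ∈ Set.Icc (k + 1) n) {ω : Ω}
    (h : ω ∈ A (j + 1) → Selectable (policyState U n k p A j ω) (U (j + 1) ω))
    (hloss : loss U n k p A j ω = 0)
    (htie : ¬ (Selectable (policyState U n k p A j ω) (U (j + 1) ω) ∧
      valueToGo (n - (j + 1)) (policyState U n k p A j ω).1 (policyState U n k p A j ω).2 =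
        1 + valueToGo (n - (j + 1)) (nextState (policyState U n k p A j ω) (U (j + 1) ω)).1
          (nextState (policyState U n k p A j ω) (U (j + 1) ω)).2)) :
    ω ∈ A (j + 1) ↔ U (j + 1) ω ∈
      Set.Icc (lowerThreshold n (j + 1) (policyState U n k p A j ω).1 (policyState U n k p A j ω).2)
        (upperThreshold n (j + 1) (policyState U n k p A j ω).1
          (policyState U n k p A j ω).2) := by
  rw [mem_Icc_thresholds_iff (policyState_mem hU hp j ω) (hU _ ⟨by omega, hj.2⟩ ω)]
  rw [loss, sub_eq_zero, stepReward] at hloss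
  by_cases hω : ω ∈ A (j + 1)
  · rw [policyState_succ_of_mem hj hω, if_pos (h hω), Set.indicator_of_mem hω] at hloss
    exact iff_of_true hω ⟨h hω, max_eq_right_iff.mp hloss⟩
  · rw [policyState_succ_of_notMem hω, Set.indicator_of_notMem hω, zero_add] at hloss
    refine iff_of_false hω fun hsel => htie ⟨hsel.1, ?_⟩
    rw [if_pos hsel.1] at hloss
    exact le_antisymm hsel.2 (max_eq_left_iff.mp hloss)

variable [mΩ : MeasurableSpace Ω] {μ : Measure Ω} {ℋ : ℕ → MeasurableSpace Ω}

lemma measurable_policyState (hU : IsUniformSequence μ ℋ U n)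
    (hA : ∀ j ∈ Set.Icc (k + 1) n, MeasurableSet[ℋ j] (A j)) (j : ℕ) :
    Measurable[ℋ j] (policyState U n k p A j) := by
  classical
  induction j with
  | zero => exact measurable_const
  | succ j ih =>
    replace ih := ih.mono (hU.mono j.le_succ) le_rfl
    by_cases hj : j + 1 ∈ Set.Icc (k + 1) n
    · have : policyState U n k p A (j + 1) = fun ω => if ω ∈ A (j + 1) then
          nextState (policyState U n k p A j ω) (U (j + 1) ω) else policyState U n k p A j ω := by
        funext ω
        split_ifs with h
        · exact policyState_succ_of_mem hj h
        · exact policyState_succ_of_notMem h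
      rw [this]
      refine Measurable.ite (m := ℋ (j + 1)) (hA _ hj) ?_ ih
      have hpair : Measurable[ℋ (j + 1)] fun ω => (policyState U n k p A j ω, U (j + 1) ω) :=
        Measurable.prodMk ih (hU.measurable _ ⟨by omega, hj.2⟩)
      exact measurable_nextState.comp hpair
    · have : policyState U n k p A (j + 1) = policyState U n k p A j :=
        funext fun ω => trackState_succ_of_notMem fun h => hj h.1
      rwa [this]

/-- The selections of `A` are almost surely allowed by the states in which they are made. -/
def IsAllowed (μ : Measure Ω) (U : ℕ → Ω → ℝ) (n k : ℕ) (p : ℝ × Fin 2) (A : ℕ → Set Ω) : Prop :=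
  ∀ᵐ ω ∂μ, ∀ j, j + 1 ∈ Set.Icc (k + 1) n → ω ∈ A (j + 1) →
    Selectable (policyState U n k p A j ω) (U (j + 1) ω)

lemma IsAllowed.loss_nonneg (h : IsAllowed μ U n k p A) {j : ℕ} (hj : j + 1 ∈ Set.Icc (k + 1) n) :
    0 ≤ᵐ[μ] loss U n k p A j := by
  filter_upwards [h] with ω hω
  exact UnimodalSelection.loss_nonneg hj (hω j hj)

variable [IsProbabilityMeasure μ]

lemma integrable_indicator_of_adapted (hU : IsUniformSequence μ ℋ U n)
    (hA : ∀ j ∈ Set.Icc (k + 1) n, MeasurableSet[ℋ j] (A j)) {j : ℕ}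
    (hj : j ∈ Set.Icc (k + 1) n) : Integrable ((A j).indicator fun _ => (1 : ℝ)) μ :=
  (integrable_const 1).indicator (hU.le j hj.2 _ (hA j hj))

lemma integrable_valueToGo_policyState (hU : IsUniformSequence μ ℋ U n)
    (hp : p.1 ∈ Set.Icc (0 : ℝ) 1) (hA : ∀ j ∈ Set.Icc (k + 1) n, MeasurableSet[ℋ j] (A j)) {j : ℕ}
    (hj : j ≤ n) (m : ℕ) :
    Integrable (fun ω => valueToGo m (policyState U n k p A j ω).1 (policyState U n k p A j ω).2)
      μ := by
  obtain ⟨C, hC⟩ := exists_abs_valueToGo_le m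
  exact Integrable.of_bound ((measurable_valueToGo m).comp
    ((measurable_policyState hU hA j).mono (hU.le j hj) le_rfl)).aestronglyMeasurable C
    (Filter.Eventually.of_forall fun ω => hC _ (policyState_mem hU.mem hp j ω))

lemma integrable_loss (hU : IsUniformSequence μ ℋ U n)
    (hp : p.1 ∈ Set.Icc (0 : ℝ) 1) (hA : ∀ j ∈ Set.Icc (k + 1) n, MeasurableSet[ℋ j] (A j)) {j : ℕ}
    (hj : j + 1 ∈ Set.Icc (k + 1) n) : Integrable (loss U n k p A j) μ :=
  (hU.integral_stepReward hj.2 (measurable_policyState hU hA j) (policyState_mem hU.mem hp j)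
    _).1.sub ((integrable_indicator_of_adapted hU hA hj).add
      (integrable_valueToGo_policyState hU hp hA hj.2 _))

lemma integral_loss (hU : IsUniformSequence μ ℋ U n)
    (hp : p.1 ∈ Set.Icc (0 : ℝ) 1) (hA : ∀ j ∈ Set.Icc (k + 1) n, MeasurableSet[ℋ j] (A j)) {j : ℕ}
    (hj : j + 1 ∈ Set.Icc (k + 1) n) :
    ∫ ω, loss U n k p A j ω ∂μ =
      ∫ ω, valueToGo (n - j) (policyState U n k p A j ω).1 (policyState U n k p A j ω).2 ∂μ -
      (∫ ω, (A (j + 1)).indicator (fun _ => (1 : ℝ)) ω ∂μ +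
        ∫ ω, valueToGo (n - (j + 1)) (policyState U n k p A (j + 1) ω).1
          (policyState U n k p A (j + 1) ω).2 ∂μ) := by
  have h1 := integrable_indicator_of_adapted hU hA hj
  have h2 := integrable_valueToGo_policyState hU hp hA hj.2 (n - (j + 1))
  obtain ⟨h3, h4⟩ := hU.integral_stepReward hj.2 (measurable_policyState hU hA j)
    (policyState_mem hU.mem hp j) (n - (j + 1))
  have hn : n - (j + 1) + 1 = n - j := by have := hj.2; omega
  simp only [loss]
  refine (integral_sub h3 (h1.add h2)).trans ?_
  rw [h4, hn]
  exact congrArg _ (integral_add h1 h2)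

/-- The expected number of selections falls short of the value by the sum of the expected losses. -/
lemma integral_numSelected_add_sum_loss (hU : IsUniformSequence μ ℋ U n)
    (hp : p.1 ∈ Set.Icc (0 : ℝ) 1) (hA : ∀ j ∈ Set.Icc (k + 1) n, MeasurableSet[ℋ j] (A j))
    (hk : k ≤ n) :
    ∫ ω, numSelected A (k + 1) n ω ∂μ + ∑ j ∈ Finset.Ico k n, ∫ ω, loss U n k p A j ω ∂μ =
      valueToGo (n - k) p.1 p.2 := by
  have key : ∀ l, k ≤ l → l ≤ n →
      ∑ j ∈ Finset.Ico k l, ∫ ω, (A (j + 1)).indicator (fun _ => (1 : ℝ)) ω ∂μ +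
        ∫ ω, valueToGo (n - l) (policyState U n k p A l ω).1 (policyState U n k p A l ω).2 ∂μ +
        ∑ j ∈ Finset.Ico k l, ∫ ω, loss U n k p A j ω ∂μ = valueToGo (n - k) p.1 p.2 := by
    intro l hl
    induction l, hl using Nat.le_induction with
    | base => simp [policyState_of_le]
    | succ l hl ih =>
      intro hln
      rw [Finset.sum_Ico_succ_top hl, Finset.sum_Ico_succ_top hl,
        integral_loss hU hp hA ⟨by omega, hln⟩]
      linarith [ih (by omega)]
  have hnum : ∫ ω, numSelected A (k + 1) n ω ∂μ =
      ∑ j ∈ Finset.Ico k n, ∫ ω, (A (j + 1)).indicator (fun _ => (1 : ℝ)) ω ∂μ := by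
    simp only [numSelected]
    rw [integral_finsetSum _ fun j hj =>
      integrable_indicator_of_adapted hU hA (Finset.mem_Icc.mp hj)]
    rw [Finset.sum_Ico_add' (fun j => ∫ ω, (A j).indicator (fun _ => (1 : ℝ)) ω ∂μ) k n 1]
    rfl
  have h := key n hk le_rfl
  simp only [Nat.sub_self, valueToGo, integral_zero, add_zero] at h
  rw [hnum, h]

lemma IsAllowed.integral_numSelected_le (h : IsAllowed μ U n k p A)
    (hU : IsUniformSequence μ ℋ U n) (hp : p.1 ∈ Set.Icc (0 : ℝ) 1)
    (hA : ∀ j ∈ Set.Icc (k + 1) n, MeasurableSet[ℋ j] (A j)) (hk : k ≤ n) :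
    ∫ ω, numSelected A (k + 1) n ω ∂μ ≤ valueToGo (n - k) p.1 p.2 := by
  rw [← integral_numSelected_add_sum_loss hU hp hA hk]
  refine le_add_of_nonneg_right (Finset.sum_nonneg fun j hj => ?_)
  rw [Finset.mem_Ico] at hj
  exact integral_nonneg_of_ae (h.loss_nonneg ⟨by omega, hj.2⟩)

lemma IsAllowed.loss_ae_eq_zero (h : IsAllowed μ U n k p A)
    (hU : IsUniformSequence μ ℋ U n) (hp : p.1 ∈ Set.Icc (0 : ℝ) 1)
    (hA : ∀ j ∈ Set.Icc (k + 1) n, MeasurableSet[ℋ j] (A j)) (hk : k ≤ n)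
    (hopt : ∫ ω, numSelected A (k + 1) n ω ∂μ = valueToGo (n - k) p.1 p.2) {j : ℕ}
    (hj : j + 1 ∈ Set.Icc (k + 1) n) : loss U n k p A j =ᵐ[μ] 0 := by
  have hsum := integral_numSelected_add_sum_loss hU hp hA hk
  rw [hopt, add_eq_left, Finset.sum_eq_zero_iff_of_nonneg fun i hi => by
    rw [Finset.mem_Ico] at hi
    exact integral_nonneg_of_ae (h.loss_nonneg ⟨by omega, hi.2⟩)] at hsum
  refine (integral_eq_zero_iff_of_nonneg_ae (h.loss_nonneg hj) (integrable_loss hU hp hA hj)).mp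
    (hsum j (Finset.mem_Ico.mpr ⟨?_, hj.2⟩))
  exact Nat.le_of_lt_succ hj.1

/-- `A` makes the decisions of the thresholds in its own states. -/
def FollowsThresholds (U : ℕ → Ω → ℝ) (n k : ℕ) (p : ℝ × Fin 2) (A : ℕ → Set Ω) (ω : Ω) : Prop :=
  ∀ j, j + 1 ∈ Set.Icc (k + 1) n → (ω ∈ A (j + 1) ↔ U (j + 1) ω ∈
    Set.Icc (lowerThreshold n (j + 1) (policyState U n k p A j ω).1 (policyState U n k p A j ω).2)
      (upperThreshold n (j + 1) (policyState U n k p A j ω).1 (policyState U n k p A j ω).2))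

/-- A feasible policy that attains the value follows the thresholds. -/
lemma IsAllowed.ae_followsThresholds (h : IsAllowed μ U n k p A)
    (hU : IsUniformSequence μ ℋ U n) (hp : p.1 ∈ Set.Icc (0 : ℝ) 1)
    (hA : ∀ j ∈ Set.Icc (k + 1) n, MeasurableSet[ℋ j] (A j)) (hk : k ≤ n)
    (hopt : ∫ ω, numSelected A (k + 1) n ω ∂μ = valueToGo (n - k) p.1 p.2) :
    ∀ᵐ ω ∂μ, FollowsThresholds U n k p A ω := by
  refine ae_all_iff.mpr fun j => ?_
  by_cases hj : j + 1 ∈ Set.Icc (k + 1) n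
  swap
  · exact Filter.Eventually.of_forall fun ω h => absurd h hj
  have htie := hU.ae_notMem hj.2 (measurable_policyState (p := p) hU hA j)
    (policyState_mem hU.mem hp j)
    (N := {q | Selectable q.1 q.2} ∩ {q | valueToGo (n - (j + 1)) q.1.1 q.1.2 =
      1 + valueToGo (n - (j + 1)) (nextState q.1 q.2).1 (nextState q.1 q.2).2})
    (measurableSet_selectable.inter (measurableSet_eq_fun
      ((measurable_valueToGo (n - (j + 1))).comp measurable_fst)
      (((measurable_valueToGo (n - (j + 1))).comp measurable_nextState).const_add 1)))
    (fun q hq => finite_ties (n - (j + 1)) hq)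
  filter_upwards [h, h.loss_ae_eq_zero hU hp hA hk hopt hj, htie] with ω h1 h2 h3 _
  exact mem_iff_of_loss_eq_zero hU.mem hp hj (h1 j hj) h2 h3

/-- A policy that follows the thresholds is feasible and attains the value. -/
lemma FollowsThresholds.isAllowed_and_integral_eq (h : ∀ ω, FollowsThresholds U n k p A ω)
    (hU : IsUniformSequence μ ℋ U n) (hp : p.1 ∈ Set.Icc (0 : ℝ) 1)
    (hA : ∀ j ∈ Set.Icc (k + 1) n, MeasurableSet[ℋ j] (A j)) (hk : k ≤ n) :
    IsAllowed μ U n k p A ∧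
      ∫ ω, numSelected A (k + 1) n ω ∂μ = valueToGo (n - k) p.1 p.2 := by
  constructor
  · refine Filter.Eventually.of_forall fun ω j hj hω => ?_
    exact ((mem_Icc_thresholds_iff (policyState_mem hU.mem hp j ω)
      (hU.mem _ ⟨by omega, hj.2⟩ ω)).mp ((h ω j hj).mp hω)).1
  · rw [← integral_numSelected_add_sum_loss hU hp hA hk, Finset.sum_eq_zero, add_zero]
    intro j hj
    rw [Finset.mem_Ico] at hj
    have hj' : j + 1 ∈ Set.Icc (k + 1) n := ⟨by omega, hj.2⟩
    rw [← integral_zero Ω ℝ (μ := μ)]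
    exact congrArg (integral μ) (funext fun ω => loss_eq_zero hU.mem hp hj' (h ω j hj'))

end

section

/-! ### The threshold policy from an arbitrary state -/

/-- The state at time `j` when the thresholds are used from time `k + 1` on, starting from `p`. -/
noncomputable def thresholdState (n k : ℕ) (p : ℝ × Fin 2) (w : ℕ → ℝ) : ℕ → ℝ × Fin 2
  | 0 => p
  | j + 1 =>
      let q := thresholdState n k p w j
      if k < j + 1 ∧ w (j + 1) ∈
          Set.Icc (lowerThreshold n (j + 1) q.1 q.2) (upperThreshold n (j + 1) q.1 q.2) then
        nextState q (w (j + 1))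
      else q

/-- The policy that uses the thresholds from time `k + 1` on, starting from `p`. Only its events at
times after `k` matter. -/
def thresholdPolicy {Ω : Type*} (U : ℕ → Ω → ℝ) (n k : ℕ) (p : ℝ × Fin 2) : ℕ → Set Ω :=
  fun j => {ω |
    let q := thresholdState n k p (fun i => U i ω) (j - 1)
    U j ω ∈ Set.Icc (lowerThreshold n j q.1 q.2) (upperThreshold n j q.1 q.2)}

lemma state_eq_thresholdState (n : ℕ) (w : ℕ → ℝ) (j : ℕ) :
    state (lowerThreshold n) (upperThreshold n) w j = thresholdState n 0 (0, 0) w j := by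
  induction j with
  | zero => rfl
  | succ j ih => simp [state, thresholdState, nextState, ih]

lemma intervalPolicy_eq_thresholdPolicy {Ω : Type*} (n : ℕ) (F : ℝ → ℝ) (X : ℕ → Ω → ℝ) :
    intervalPolicy (lowerThreshold n) (upperThreshold n) F X =
      thresholdPolicy (fun i ω => F (X i ω)) n 0 (0, 0) := by
  funext j
  simp only [intervalPolicy, thresholdPolicy, state_eq_thresholdState]

variable {Ω : Type*} {U : ℕ → Ω → ℝ} {n k : ℕ} {p : ℝ × Fin 2} {A : ℕ → Set Ω}

lemma mem_thresholdPolicy_succ {j : ℕ} {ω : Ω} :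
    ω ∈ thresholdPolicy U n k p (j + 1) ↔ U (j + 1) ω ∈
      Set.Icc (lowerThreshold n (j + 1) (thresholdState n k p (fun i => U i ω) j).1
          (thresholdState n k p (fun i => U i ω) j).2)
        (upperThreshold n (j + 1) (thresholdState n k p (fun i => U i ω) j).1
          (thresholdState n k p (fun i => U i ω) j).2) := Iff.rfl

lemma thresholdState_succ {j : ℕ} {ω : Ω}
    [Decidable (k < j + 1 ∧ ω ∈ thresholdPolicy U n k p (j + 1))] :
    thresholdState n k p (fun i => U i ω) (j + 1) =
      if k < j + 1 ∧ ω ∈ thresholdPolicy U n k p (j + 1) then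
        nextState (thresholdState n k p (fun i => U i ω) j) (U (j + 1) ω)
      else thresholdState n k p (fun i => U i ω) j := by
  simp only [thresholdState, mem_thresholdPolicy_succ]

/-- To follow the thresholds in one's own states is to agree with the threshold policy. -/
lemma followsThresholds_iff {ω : Ω} : FollowsThresholds U n k p A ω ↔
    ∀ j, j + 1 ∈ Set.Icc (k + 1) n → (ω ∈ A (j + 1) ↔ ω ∈ thresholdPolicy U n k p (j + 1)) := by
  classical
  have step : ∀ j < n, policyState U n k p A j ω = thresholdState n k p (fun i => U i ω) j →
      (j + 1 ∈ Set.Icc (k + 1) n → (ω ∈ A (j + 1) ↔ ω ∈ thresholdPolicy U n k p (j + 1))) →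
      policyState U n k p A (j + 1) ω = thresholdState n k p (fun i => U i ω) (j + 1) := by
    intro j hj hst h
    rw [thresholdState_succ, ← hst]
    split_ifs with hc
    · exact policyState_succ_of_mem ⟨hc.1, hj⟩ ((h ⟨hc.1, hj⟩).mpr hc.2)
    · exact trackState_succ_of_notMem fun hm => hc ⟨hm.1.1, (h hm.1).mp hm.2⟩
  constructor
  · intro h
    have hst : ∀ j ≤ n, policyState U n k p A j ω = thresholdState n k p (fun i => U i ω) j := by
      intro j
      induction j with
      | zero => exact fun _ => rfl
      | succ j ih =>
        intro hj
        refine step j hj (ih (by omega)) fun hj' => ?_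
        rw [h j hj', ih (by omega), mem_thresholdPolicy_succ]
    intro j hj
    have := hj.2
    rw [h j hj, hst j (by omega), mem_thresholdPolicy_succ]
  · intro h
    have hst : ∀ j ≤ n, policyState U n k p A j ω = thresholdState n k p (fun i => U i ω) j := by
      intro j
      induction j with
      | zero => exact fun _ => rfl
      | succ j ih => exact fun hj => step j hj (ih (by omega)) (h j)
    intro j hj
    have := hj.2
    rw [h j hj, hst j (by omega), mem_thresholdPolicy_succ]

variable {X : ℕ → Ω → ℝ} {F : ℝ → ℝ}

lemma comap_le_history {i : ℕ} (hi : 1 ≤ i) :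
    MeasurableSpace.comap (X i) inferInstance ≤ history X i :=
  le_iSup₂_of_le i ⟨hi, le_rfl⟩ le_rfl

variable [mΩ : MeasurableSpace Ω] {μ : Measure Ω} {ℋ : ℕ → MeasurableSpace Ω}

lemma measurableSet_thresholdPolicy_succ (hU : IsUniformSequence μ ℋ U n) {j : ℕ} (hj : j < n)
    (hS : Measurable[ℋ j] fun ω => thresholdState n k p (fun i => U i ω) j)
    (hmem : ∀ ω, (thresholdState n k p (fun i => U i ω) j).1 ∈ Set.Icc (0 : ℝ) 1) :
    MeasurableSet[ℋ (j + 1)] (thresholdPolicy U n k p (j + 1)) := by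
  have hj' : j + 1 ∈ Set.Icc 1 n := ⟨by omega, hj⟩
  have hpair : Measurable[ℋ (j + 1)] fun ω =>
      (thresholdState n k p (fun i => U i ω) j, U (j + 1) ω) :=
    Measurable.prodMk (hS.mono (hU.mono j.le_succ) le_rfl) (hU.measurable _ hj')
  have hset : thresholdPolicy U n k p (j + 1) =
      (fun ω => (thresholdState n k p (fun i => U i ω) j, U (j + 1) ω)) ⁻¹'
        ({q | Selectable q.1 q.2} ∩ {q | valueToGo (n - (j + 1)) q.1.1 q.1.2 ≤
          1 + valueToGo (n - (j + 1)) (nextState q.1 q.2).1 (nextState q.1 q.2).2}) := by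
    ext ω
    rw [mem_thresholdPolicy_succ, mem_Icc_thresholds_iff (hmem ω) (hU.mem _ hj' ω)]
    rfl
  rw [hset]
  exact hpair (measurableSet_selectable.inter (measurableSet_le
    ((measurable_valueToGo (n - (j + 1))).comp measurable_fst)
    (((measurable_valueToGo (n - (j + 1))).comp measurable_nextState).const_add 1)))

lemma measurable_thresholdState (hU : IsUniformSequence μ ℋ U n) (hp : p.1 ∈ Set.Icc (0 : ℝ) 1)
    {j : ℕ} (hj : j ≤ n) :
    (Measurable[ℋ j] fun ω => thresholdState n k p (fun i => U i ω) j) ∧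
      ∀ ω, (thresholdState n k p (fun i => U i ω) j).1 ∈ Set.Icc (0 : ℝ) 1 := by
  classical
  induction j with
  | zero => exact ⟨measurable_const, fun _ => hp⟩
  | succ j ih =>
    obtain ⟨h1, h2⟩ := ih (by omega)
    have hj' : j + 1 ∈ Set.Icc 1 n := ⟨by omega, hj⟩
    simp_rw [thresholdState_succ]
    constructor
    · have h1' := h1.mono (hU.mono j.le_succ) le_rfl
      have hpair : Measurable[ℋ (j + 1)] fun ω =>
          (thresholdState n k p (fun i => U i ω) j, U (j + 1) ω) :=
        Measurable.prodMk h1' (hU.measurable _ hj')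
      refine Measurable.ite (m := ℋ (j + 1)) ?_ (measurable_nextState.comp hpair) h1'
      exact @MeasurableSet.inter _ (ℋ (j + 1)) _ _ (@MeasurableSet.const _ (ℋ (j + 1)) _)
        (measurableSet_thresholdPolicy_succ hU hj h1 h2)
    · intro ω
      split_ifs
      · exact hU.mem _ hj' ω
      · exact h2 ω

lemma measurableSet_thresholdPolicy (hU : IsUniformSequence μ ℋ U n)
    (hp : p.1 ∈ Set.Icc (0 : ℝ) 1) {j : ℕ} (hj : j ∈ Set.Icc 1 n) :
    MeasurableSet[ℋ j] (thresholdPolicy U n k p j) := by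
  obtain ⟨j, rfl⟩ := Nat.exists_eq_add_of_le' hj.1
  obtain ⟨h1, h2⟩ := measurable_thresholdState (k := k) hU hp (Nat.le_of_succ_le hj.2)
  exact measurableSet_thresholdPolicy_succ hU hj.2 h1 h2

/-- Feasibility from the state `(s, r)` on, decision by decision. -/
lemma mem_policiesFrom_iff {s : ℝ} {r : Fin 2} :
    A ∈ policiesFrom μ F X n (k + 1) s r ↔
      (∀ j ∈ Set.Icc (k + 1) n, MeasurableSet[history X j] (A j)) ∧
        IsAllowed μ (fun i ω => F (X i ω)) n k (s, r) A := by
  refine and_congr_right fun _ => Filter.eventually_congr (Filter.Eventually.of_forall fun ω => ?_)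
  refine (isPhaseOn_iff_selectable (p := (s, r)) (w := fun i => F (X i ω))
    (T := {j ∈ Set.Icc (k + 1) n | ω ∈ A j}) (k := k) (fun i hi => hi.1.1) (fun i hi => hi.1.2)
    (x := Function.update (fun j => F (X j ω)) k s) (Function.update_self _ _ _) ?_).trans ?_
  · intro i hi
    exact Function.update_of_ne (Nat.ne_of_gt hi.1.1) _ _
  · exact ⟨fun h j hj hω => h j ⟨hj, hω⟩, fun h j hj => h j hj.1 hj.2⟩

/-! ### The observations on the scale of the distribution function -/

variable [IsProbabilityMeasure μ]

/-- The probability integral transform. -/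
lemma map_comp_cdf_eq_uniform {Y : Ω → ℝ} (hY : Measurable Y) {F : ℝ → ℝ} (hF : Continuous F)
    (hdist : ∀ x, μ.real {ω | Y ω ≤ x} = F x) :
    μ.map (fun ω => F (Y ω)) = volume.restrict (Set.Icc 0 1) := by
  have hprob : IsProbabilityMeasure (μ.map Y) := Measure.isProbabilityMeasure_map hY.aemeasurable
  have hcdf : ∀ x, cdf (μ.map Y) x = F x := fun x => by
    rw [cdf_eq_real, map_measureReal_apply hY measurableSet_Iic, ← hdist x]
    rfl
  have hF' : ⇑(cdf (μ.map Y)) = F := funext hcdf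
  have hmono : Monotone F := hF' ▸ monotone_cdf _
  have hF0 : ∀ x, 0 ≤ F x := fun x => hdist x ▸ measureReal_nonneg
  have hF1 : ∀ x, F x ≤ 1 := fun x => hdist x ▸ measureReal_le_one
  have hbot := hF' ▸ tendsto_cdf_atBot (μ.map Y)
  have htop := hF' ▸ tendsto_cdf_atTop (μ.map Y)
  have hsurj : ∀ u, 0 < u → u < 1 → ∃ x, F x = u := fun u h0 h1 => by
    obtain ⟨a, ha⟩ := (hbot.eventually (gt_mem_nhds h0)).exists
    obtain ⟨b, hb⟩ := (htop.eventually (lt_mem_nhds h1)).exists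
    exact mem_range_of_exists_le_of_exists_ge hF ⟨a, ha.le⟩ ⟨b, hb.le⟩
  have hFY : Measurable fun ω => F (Y ω) := hF.measurable.comp hY
  have hprob' := Measure.isProbabilityMeasure_map (μ := μ) hFY.aemeasurable
  refine Measure.ext_of_Iic _ _ fun u => ?_
  have hr : volume.restrict (Set.Icc (0 : ℝ) 1) (Set.Iic u) = ENNReal.ofReal (min u 1) := by
    have : Set.Iic u ∩ Set.Icc 0 1 = Set.Icc 0 (min u 1) := by
      ext x
      simp only [Set.mem_inter_iff, Set.mem_Iic, Set.mem_Icc, le_min_iff]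
      tauto
    rw [Measure.restrict_apply measurableSet_Iic, this, Real.volume_Icc, sub_zero]
  rw [hr, Measure.map_apply hFY measurableSet_Iic]
  rcases lt_or_ge u 0 with hu | hu
  · have : (fun ω => F (Y ω)) ⁻¹' Set.Iic u = ∅ :=
      Set.eq_empty_of_forall_notMem fun ω hω => (hu.trans_le (hF0 (Y ω))).not_ge hω
    rw [this, measure_empty, ENNReal.ofReal_of_nonpos ((min_le_left _ _).trans hu.le)]
  rcases le_or_gt 1 u with hu1 | hu1
  · have : (fun ω => F (Y ω)) ⁻¹' Set.Iic u = Set.univ :=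
      Set.eq_univ_of_forall fun ω => (hF1 (Y ω)).trans hu1
    rw [this, measure_univ, min_eq_right hu1, ENNReal.ofReal_one]
  rw [min_eq_left hu1.le, ← ofReal_measureReal]
  congr 1
  apply le_antisymm
  · refine le_of_forall_gt_imp_ge_of_dense fun v hv => ?_
    rcases le_or_gt 1 v with hv1 | hv1
    · exact measureReal_le_one.trans hv1
    obtain ⟨x, hx⟩ := hsurj v (hu.trans_lt hv) hv1
    rw [← hx, ← hdist x]
    refine measureReal_mono fun ω hω => ?_
    by_contra h
    have h1 : F x ≤ F (Y ω) := hmono (not_le.mp h).le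
    have h2 : F (Y ω) ≤ u := hω
    linarith
  · rcases hu.eq_or_lt with rfl | hu0
    · exact measureReal_nonneg
    obtain ⟨x, hx⟩ := hsurj u hu0 hu1
    conv_lhs => rw [← hx, ← hdist x]
    exact measureReal_mono fun ω hω => (hmono hω).trans hx.le

lemma isUniformSequence_comp (hX : ∀ i ∈ Set.Icc 1 n, Measurable (X i))
    (hindep : iIndepFun (fun i : Set.Icc 1 n => X i) μ) (hF : Continuous F)
    (hdist : ∀ i ∈ Set.Icc 1 n, ∀ x : ℝ, μ.real {ω | X i ω ≤ x} = F x) :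
    IsUniformSequence μ (history X) (fun i ω => F (X i ω)) n where
  mono i j hij := biSup_mono fun l hl => ⟨hl.1, hl.2.trans hij⟩
  le j hj := iSup₂_le fun i hi => (hX i ⟨hi.1, hi.2.trans hj⟩).comap_le
  measurable j hj := hF.measurable.comp
    ((comap_measurable (X j)).mono (comap_le_history hj.1) le_rfl)
  mem j hj ω := by
    rw [← hdist j hj]
    exact ⟨measureReal_nonneg, measureReal_le_one⟩
  indep j hj := by
    have hj' : j + 1 ∈ Set.Icc 1 n := ⟨by omega, hj⟩
    have h := indep_iSup_of_disjoint (fun i : Set.Icc 1 n => (hX i i.2).comap_le) hindep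
      (S := {i | (i : ℕ) ≤ j}) (T := {⟨j + 1, hj'⟩})
      (Set.disjoint_singleton_right.mpr fun h : j + 1 ≤ j => by omega)
    refine indep_of_indep_of_le_left (indep_of_indep_of_le_right h ?_) ?_
    · refine le_trans ?_ (le_iSup₂_of_le ⟨j + 1, hj'⟩ rfl le_rfl)
      exact (hF.measurable.comp (comap_measurable (X (j + 1)))).comap_le
    · exact iSup₂_le fun i hi => le_iSup₂_of_le (f := fun (i : Set.Icc 1 n)
        (_ : i ∈ {i : Set.Icc 1 n | (i : ℕ) ≤ j}) => MeasurableSpace.comap (X i) inferInstance)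
        ⟨i, hi.1, hi.2.trans hj.le⟩ hi.2 le_rfl
  map_eq j hj := map_comp_cdf_eq_uniform (hX j hj) hF (hdist j hj)

lemma IsUniformSequence.ae_ne (hU : IsUniformSequence μ ℋ U n) {i j : ℕ} (hi : i ∈ Set.Icc 1 n)
    (hj : j ∈ Set.Icc 1 n) (hij : i < j) : ∀ᵐ ω ∂μ, U i ω ≠ U j ω := by
  obtain ⟨j, rfl⟩ := Nat.exists_eq_add_of_le' hj.1
  have hUi : Measurable[ℋ j] (U i) :=
    (hU.measurable i hi).mono (hU.mono (Nat.le_of_lt_succ hij)) le_rfl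
  have h := hU.ae_notMem hj.2 (σ := fun ω => (U i ω, 0)) (Measurable.prodMk hUi measurable_const)
    (fun ω => hU.mem i hi ω) (N := {q | q.1.1 = q.2})
    (measurableSet_eq_fun measurable_fst.fst measurable_snd)
    (fun q _ => (Set.finite_singleton q.1).subset fun x hx => hx.2.symm)
  exact h

/-- Almost surely the distribution function does not identify any two observations. -/
lemma IsUniformSequence.ae_le_iff_le (hU : IsUniformSequence μ ℋ (fun i ω => F (X i ω)) n)
    (hdist : ∀ i ∈ Set.Icc 1 n, ∀ x : ℝ, μ.real {ω | X i ω ≤ x} = F x) :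
    ∀ᵐ ω ∂μ, ∀ i ∈ Set.Icc 1 n, ∀ j ∈ Set.Icc 1 n,
      X i ω ≤ X j ω ↔ F (X i ω) ≤ F (X j ω) := by
  have h : ∀ᵐ ω ∂μ, ∀ i j, i ∈ Set.Icc 1 n → j ∈ Set.Icc 1 n → i < j →
      F (X i ω) ≠ F (X j ω) := by
    simp_rw [ae_all_iff]
    exact fun i j hi hj hij => hU.ae_ne hi hj hij
  filter_upwards [h] with ω hω i hi j hj
  have hF : Monotone F := fun x y hxy => by
    rw [← hdist i hi x, ← hdist i hi y]
    exact measureReal_mono fun ω hω => le_trans hω hxy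
  refine ⟨fun h => hF h, fun h => ?_⟩
  by_contra! hlt
  have heq := le_antisymm h (hF hlt.le)
  rcases lt_trichotomy i j with hij | rfl | hij
  · exact hω i j hi hj hij heq
  · exact hlt.false
  · exact hω j i hj hi hij heq.symm

/-- Unimodality depends only on the order of the values, and a sequence stays unimodal when a
smallest value is put in front of it. -/
lemma isUnimodalOn_iff_insert_zero {x y : ℕ → ℝ} {T : Set ℕ} (hT : ∀ i ∈ T, 1 ≤ i)
    (hxy : ∀ i ∈ T, ∀ j ∈ T, x i ≤ x j ↔ y i ≤ y j) (hy : ∀ i ∈ T, 0 ≤ y i) :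
    IsUnimodalOn x T ↔ IsUnimodalOn (Function.update y 0 0) (insert 0 T) := by
  have hne : ∀ i ∈ T, i ≠ 0 := fun i hi => (Nat.one_le_iff_ne_zero).mp (hT i hi)
  have hup : ∀ i ∈ T, Function.update y 0 0 i = y i :=
    fun i hi => Function.update_of_ne (hne i hi) _ _
  have h00 : Function.update y 0 0 0 = 0 := Function.update_self _ _ _
  constructor
  · rintro (rfl | ⟨t, ht, hm, ha⟩)
    · refine Or.inr ⟨0, Or.inl rfl, ?_, ?_⟩
      · exact (Set.subsingleton_singleton.anti fun i hi => by simpa using hi.1).monotoneOn _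
      · exact (Set.subsingleton_singleton.anti fun i hi => by simpa using hi.1).antitoneOn _
    · refine Or.inr ⟨t, Or.inr ht, ?_, ?_⟩
      · rintro a ⟨rfl | haT, hat⟩ b ⟨rfl | hbT, hbt⟩ hab
        · exact le_rfl
        · rw [h00, hup b hbT]
          exact hy b hbT
        · exact absurd (Nat.le_zero.mp hab) (hne a haT)
        · rw [hup a haT, hup b hbT, ← hxy a haT b hbT]
          exact hm ⟨haT, hat⟩ ⟨hbT, hbt⟩ hab
      · rintro a ⟨rfl | haT, hat⟩ b ⟨rfl | hbT, hbt⟩ hab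
        · exact le_rfl
        · exact absurd (Nat.le_zero.mp hat) (hne t ht)
        · exact absurd (Nat.le_zero.mp hbt) (hne t ht)
        · rw [hup a haT, hup b hbT, ← hxy b hbT a haT]
          exact ha ⟨haT, hat⟩ ⟨hbT, hbt⟩ hab
  · rintro (h | ⟨t, ht, hm, ha⟩)
    · exact absurd h (Set.insert_nonempty _ _).ne_empty
    rcases T.eq_empty_or_nonempty with hT0 | hT0
    · exact Or.inl hT0
    -- if the turning place is the added one, the first element of `T` takes over
    obtain ⟨t', ht', htt', hmono⟩ : ∃ t' ∈ T, t ≤ t' ∧ MonotoneOn x {j ∈ T | j ≤ t'} := by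
      rcases ht with rfl | ht
      · refine ⟨sInf T, Nat.sInf_mem hT0, Nat.zero_le _, ?_⟩
        exact (Set.subsingleton_singleton (a := sInf T)).anti
          (fun i hi => le_antisymm hi.2 (Nat.sInf_le hi.1)) |>.monotoneOn _
      · refine ⟨t, ht, le_rfl, ?_⟩
        rintro a ⟨haT, hat⟩ b ⟨hbT, hbt⟩ hab
        rw [hxy a haT b hbT, ← hup a haT, ← hup b hbT]
        exact hm ⟨Or.inr haT, hat⟩ ⟨Or.inr hbT, hbt⟩ hab
    refine Or.inr ⟨t', ht', hmono, ?_⟩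
    · rintro a ⟨haT, hat⟩ b ⟨hbT, hbt⟩ hab
      rw [hxy b hbT a haT, ← hup a haT, ← hup b hbT]
      exact ha ⟨Or.inr haT, htt'.trans hat⟩ ⟨Or.inr hbT, htt'.trans hbt⟩ hab

lemma mem_policies_iff (hU : IsUniformSequence μ (history X) (fun i ω => F (X i ω)) n)
    (hdist : ∀ i ∈ Set.Icc 1 n, ∀ x : ℝ, μ.real {ω | X i ω ≤ x} = F x) :
    A ∈ policies μ X n ↔ A ∈ policiesFrom μ F X n 1 0 0 := by
  refine and_congr_right fun _ => Filter.eventually_congr ?_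
  filter_upwards [hU.ae_le_iff_le hdist] with ω hω
  exact isUnimodalOn_iff_insert_zero (T := {j ∈ Set.Icc 1 n | ω ∈ A j}) (fun i hi => hi.1.1)
    (fun i hi j hj => hω i hi.1 j hj.1) (fun i hi => (hU.mem i hi.1 ω).1)

end

end UnimodalSelection

theorem mainTheorem5 {Ω : Type*} [MeasurableSpace Ω] (μ : Measure Ω) [IsProbabilityMeasure μ]
    (n : ℕ) (X : ℕ → Ω → ℝ) (F : ℝ → ℝ)
    (hX : ∀ i ∈ Set.Icc 1 n, Measurable (X i))
    (hindep : iIndepFun (fun i : Set.Icc 1 n => X i) μ)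
    (hF : Continuous F)
    (hdist : ∀ i ∈ Set.Icc 1 n, ∀ x : ℝ, μ.real {ω | X i ω ≤ x} = F x) :
    -- the interval policy with thresholds `a*`, `b*` is optimal among all feasible policies
    IsOptimal μ X n (intervalPolicy (lowerThreshold n) (upperThreshold n) F X) ∧
    -- every optimal policy almost surely selects the same observations
    (∀ A : ℕ → Set Ω, IsOptimal μ X n A → ∀ i ∈ Set.Icc 1 n,
      A i =ᵐ[μ] intervalPolicy (lowerThreshold n) (upperThreshold n) F X i) ∧
    -- `v_i(s, r)` is the optimal expected number of selections from time `i` on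
    (∀ i ∈ Set.Icc 1 n, ∀ s ∈ Set.Icc (0 : ℝ) 1, ∀ r : Fin 2,
      IsGreatest ((fun A => ∫ ω, numSelected A i n ω ∂μ) '' policiesFrom μ F X n i s r)
        (value n i s r)) ∧
    -- continuity and strict monotonicity of `v_i(·, r)`
    (∀ i ∈ Set.Icc 1 n, ∀ r : Fin 2, ContinuousOn (fun s => value n i s r) (Set.Icc 0 1)) ∧
    (∀ i ∈ Set.Ico 1 n, StrictAntiOn (fun s => value n i s 0) (Set.Icc 0 1)) ∧
    (∀ i ∈ Set.Icc 1 n, StrictMonoOn (fun s => value n i s 1) (Set.Icc 0 1)) ∧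
    -- `(a*, b*)` is the only admissible pair of thresholds that attains the Bellman equation
    IsThresholds n (lowerThreshold n) (upperThreshold n) ∧
    (∀ a b : ℕ → ℝ → Fin 2 → ℝ, IsThresholds n a b →
      ((∀ i ∈ Set.Icc 1 n, ∀ s ∈ Set.Icc (0 : ℝ) 1, ∀ r : Fin 2,
          value n i s r = intervalReward n i s r (a i s r) (b i s r)) ↔
        ∀ i ∈ Set.Icc 1 n, ∀ s ∈ Set.Icc (0 : ℝ) 1, ∀ r : Fin 2,
          a i s r = lowerThreshold n i s r ∧ b i s r = upperThreshold n i s r)) := by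
  have hU := isUniformSequence_comp hX hindep hF hdist
  have hp : ((0, 0) : ℝ × Fin 2).1 ∈ Set.Icc (0 : ℝ) 1 := Set.left_mem_Icc.mpr zero_le_one
  -- the threshold policy attains the value from every state
  have hattain : ∀ k ≤ n, ∀ p : ℝ × Fin 2, p.1 ∈ Set.Icc (0 : ℝ) 1 →
      thresholdPolicy (fun i ω => F (X i ω)) n k p ∈ policiesFrom μ F X n (k + 1) p.1 p.2 ∧
      ∫ ω, numSelected (thresholdPolicy (fun i ω => F (X i ω)) n k p) (k + 1) n ω ∂μ =
        valueToGo (n - k) p.1 p.2 := by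
    intro k hk p hp
    have hmeas : ∀ j ∈ Set.Icc (k + 1) n,
        MeasurableSet[history X j] (thresholdPolicy (fun i ω => F (X i ω)) n k p j) :=
      fun j hj => measurableSet_thresholdPolicy hU hp ⟨by have := hj.1; omega, hj.2⟩
    obtain ⟨h1, h2⟩ := FollowsThresholds.isAllowed_and_integral_eq
      (fun ω => followsThresholds_iff.mpr fun _ _ => Iff.rfl) hU hp hmeas hk
    exact ⟨mem_policiesFrom_iff.mpr ⟨hmeas, h1⟩, h2⟩
  have hpol : ∀ A, A ∈ policies μ X n ↔ A ∈ policiesFrom μ F X n (0 + 1) 0 0 :=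
    fun A => mem_policies_iff hU hdist
  obtain ⟨hmem, hval⟩ := hattain 0 (Nat.zero_le n) (0, 0) hp
  rw [intervalPolicy_eq_thresholdPolicy]
  refine ⟨⟨(hpol _).mpr hmem, fun A hA => ?_⟩, fun A hA i hi => ?_, ?_, ?_, ?_, ?_,
    isThresholds_lower_upper n, fun a b hab => ?_⟩
  · obtain ⟨h1, h2⟩ := mem_policiesFrom_iff.mp ((hpol A).mp hA)
    exact (h2.integral_numSelected_le hU hp h1 (Nat.zero_le n)).trans hval.ge
  · obtain ⟨h1, h2⟩ := mem_policiesFrom_iff.mp ((hpol A).mp hA.1)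
    have hopt := le_antisymm (h2.integral_numSelected_le hU hp h1 (Nat.zero_le n))
      (hval.ge.trans (hA.2 _ ((hpol _).mpr hmem)))
    obtain ⟨j, rfl⟩ := Nat.exists_eq_add_of_le' hi.1
    filter_upwards [h2.ae_followsThresholds hU hp h1 (Nat.zero_le n) hopt] with ω hω
    exact propext (followsThresholds_iff.mp hω j ⟨by omega, hi.2⟩)
  · intro i hi s hs r
    obtain ⟨k, rfl⟩ := Nat.exists_eq_add_of_le' hi.1
    have hk : k ≤ n := Nat.le_of_succ_le hi.2
    rw [value_succ]
    refine ⟨⟨_, (hattain k hk (s, r) hs).1, (hattain k hk (s, r) hs).2⟩, ?_⟩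
    rintro _ ⟨A, hA, rfl⟩
    obtain ⟨h1, h2⟩ := mem_policiesFrom_iff.mp hA
    exact h2.integral_numSelected_le hU hs h1 hk
  · exact fun i _ r => (continuous_valueToGo (n + 1 - i) r).continuousOn
  · exact fun i hi => strictAntiOn_valueToGo_zero (by have := hi.2; omega)
  · exact fun i hi => strictMonoOn_valueToGo_one (by have := hi.2; omega)
  · have hiff : ∀ i ∈ Set.Icc 1 n, ∀ s ∈ Set.Icc (0 : ℝ) 1, ∀ r : Fin 2,
        value n i s r = intervalReward n i s r (a i s r) (b i s r) ↔
          a i s r = lowerThreshold n i s r ∧ b i s r = upperThreshold n i s r :=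
      fun i hi s hs r => value_eq_intervalReward_iff hi.2 hs (hab.lower i hi s hs r)
        (fun hr => hr ▸ hab.upper_zero i hi s hs) (fun hr => hr ▸ hab.upper_one i hi s hs)
    exact forall₅_congr hiff
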